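/- Let $\mathcal C$ be a finite semisimple $\mathbb C$-linear monoidal category, and let $\mathcal M,\mathcal N$ be finite semisimple $\mathbb C$-linear left $\mathcal C$-module categories (with $\mathbb C$-bilinear tensor product and actions, all written $\otimes$ and $\odot$). Here a $\mathbb C$-linear category is finite semisimple if it is abelian, its hom spaces are finite-dimensional, every object is a finite direct sum of simple objects, and there are finitely many simple objects up to isomorphism. Let $\mathrm{Irr}(-)$ denote a set of representatives of the isomorphism classes of simple objects. The Kitaev–Kong algebra is the $\mathbb C$-algebra $$A^{\mathcal C}_{\mathcal M,\mathcal N}=\bigoplus_{\substack{c\in\mathrm{Irr}(\mathcal C)\\ m_1,m_2\in\mathrm{Irr}(\mathcal M)\\ n_1,n_2\in\mathrm{Irr}(\mathcal N)}}\mathcal N(n_1,c\odot n_2)\otimes_{\mathbb C}\mathcal M(c\odot m_2,m_1)$$ with the following multiplication. Suppose $f\otimes g\in \mathcal N(n_1,c\odot n_2)\otimes\mathcal M(c\odot m_2,m_1)$ and $f'\otimes g'\in\mathcal N(n_2',d\odot n_3)\otimes\mathcal M(d\odot m_3,m_2')$. If $(m_2,n_2)\neq(m_2',n_2')$, then $(f\otimes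 g)(f'\otimes g')=0$. If $(m_2,n_2)=(m_2',n_2')$, let $F:n_1\to c\odot n_2\to c\odot(d\odot n_3)\cong(c\otimes d)\odot n_3$ and $G:(c\otimes d)\odot m_3\cong c\odot (d\odot m_3)\to c\odot m_2\to m_1$ be the composites built from $f,f'$ and $g,g'$; then $$(f\otimes g)(f'\otimes g')=\sum_j\big((\pi_j\odot n_3)\circ F\big)\otimes\big(G\circ(\iota_j\odot m_3)\big),$$ where $\pi_j:c\otimes d\to x_j$, $\iota_j:x_j\to c\otimes d$ ($x_j\in\mathrm{Irr}(\mathcal C)$) exhibit $c\otimes d$ as a finite direct sum of simple objects. This does not depend on the choice of the decomposition. The unit of the algebra is the sum over all $(m,n)$ of the elements obtained in the same way from $n\cong\mathbb 1\odot n$ and $\mathbb 1\odot m\cong m$ by decomposing the monoidal unit $\mathbb 1$. Let $\mathrm{rep}(A)$ be the $\mathbb C$-linear category of finite-dimensional left $A$-modules. A lax $\mathcal C$-module functor $\mathcal M\to\mathcal N$ is a $\mathbb C$-linear functor $F$ with natural morphisms $c\odot F(m)\to F(c\odot m)$ compatible with the associativity and unit isomorphisms; it is a (strong) $\mathcal C$-module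 functor if these morphisms are isomorphisms. Morphisms of either are the natural transformations compatible with these structure morphisms. Write ${}_{\mathcal C}[\mathcal M,\mathcal N]^{\mathrm{lax}}$ and ${}_{\mathcal C}[\mathcal M,\mathcal N]$ for the resulting $\mathbb C$-linear categories. Then there is a $\mathbb C$-linear equivalence $${}_{\mathcal C}[\mathcal M,\mathcal N]^{\mathrm{lax}}\simeq\mathrm{rep}(A^{\mathcal C}_{\mathcal M,\mathcal N}).$$ If $\mathcal C$ is moreover rigid (every object has a left dual and a right dual), there is a $\mathbb C$-linear equivalence $${}_{\mathcal C}[\mathcal M,\mathcal N]\simeq\mathrm{rep}(A^{\mathcal C}_{\mathcal M,\mathcal N}).$$ -/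

import Mathlib

open CategoryTheory CategoryTheory.Limits MonoidalCategory MonoidalLeftAction

universe w v₁ v₂ v₃ u₁ u₂ u₃

namespace KitaevKong

open scoped TensorProduct

noncomputable section

/-! ### Finite semisimple categories -/

attribute [local instance] Abelian.hasFiniteBiproducts

section Semisimple

variable (C : Type u₁) [Category.{v₁} C] [Abelian C] [Linear ℂ C]

/-- A `ℂ`-linear abelian category is finite semisimple if its hom spaces are finite dimensional,
every object is a finite direct sum of simple objects, and there are finitely many simple objects
up to isomorphism. -/
class FiniteSemisimple : Prop where
  finite_hom : ∀ X Y : C, FiniteDimensional ℂ (X ⟶ Y)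
  exists_decomposition : ∀ X : C, ∃ (n : ℕ) (S : Fin n → C),
    (∀ i, Simple (S i)) ∧ Nonempty (X ≅ ⨁ S)
  finite_simples : ∃ (n : ℕ) (S : Fin n → C),
    ∀ X : C, Simple X → ∃ i, Nonempty (X ≅ S i)

variable [MonoidalCategory C] (M : Type u₂) [Category.{v₂} M] [Abelian M] [Linear ℂ M]

/-- The action of `C` on `M` is `ℂ`-bilinear on morphisms. Together with `MonoidalLeftAction C M`
this says that `M` is a `ℂ`-linear left `C`-module category. -/
class LinearAction [MonoidalLeftAction C M] : Prop where
  left_add : ∀ {X Y : C} (f g : X ⟶ Y) (m : M), (f + g) ⊵ₗ m = f ⊵ₗ m + g ⊵ₗ m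
  left_smul : ∀ {X Y : C} (r : ℂ) (f : X ⟶ Y) (m : M), (r • f) ⊵ₗ m = r • (f ⊵ₗ m)
  right_add : ∀ (X : C) {m m' : M} (f g : m ⟶ m'), X ⊴ₗ (f + g) = X ⊴ₗ f + X ⊴ₗ g
  right_smul : ∀ (X : C) {m m' : M} (r : ℂ) (f : m ⟶ m'), X ⊴ₗ (r • f) = r • (X ⊴ₗ f)

end Semisimple

/-- A system of representatives `obj 0, …, obj (card - 1)` of the isomorphism classes of simple
objects of `C`; this is the set `Irr(C)`. -/
structure Irr (C : Type u₁) [Category.{v₁} C] [HasZeroMorphisms C] where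
  card : ℕ
  obj : Fin card → C
  simple : ∀ i, Simple (obj i)
  eq_of_iso : ∀ i j, Nonempty (obj i ≅ obj j) → i = j
  exists_iso : ∀ X : C, Simple X → ∃ i, Nonempty (X ≅ obj i)

section Decomposition

variable {C : Type u₁} [Category.{v₁} C] [Abelian C] [Linear ℂ C]

/-- A decomposition of `X` as a finite direct sum of objects in `Irr(C)`. -/
structure Decomposition (I : Irr C) (X : C) where
  card : ℕ
  label : Fin card → Fin I.card
  π : ∀ j, X ⟶ I.obj (label j)
  ι : ∀ j, I.obj (label j) ⟶ X
  ι_π : ∀ j, ι j ≫ π j = 𝟙 _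
  ι_π_ne : ∀ j k, j ≠ k → ι j ≫ π k = 0
  sum_π_ι : ∑ j, π j ≫ ι j = 𝟙 X

theorem nonempty_decomposition [FiniteSemisimple C] (I : Irr C) (X : C) :
    Nonempty (Decomposition I X) := by
  obtain ⟨n, S, hS, ⟨e⟩⟩ := FiniteSemisimple.exists_decomposition X
  choose l hl using fun i => I.exists_iso (S i) (hS i)
  let a : ∀ i, S i ≅ I.obj (l i) := fun i => (hl i).some
  refine ⟨⟨n, l, fun j => e.hom ≫ biproduct.π S j ≫ (a j).hom,
    fun j => (a j).inv ≫ biproduct.ι S j ≫ e.inv, ?_, ?_, ?_⟩⟩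
  · intro j
    simp
  · intro j k h
    simp [biproduct.ι_π_ne_assoc S h]
  · have h := biproduct.total (f := S)
    have h2 : ∑ j, e.hom ≫ (biproduct.π S j ≫ biproduct.ι S j) ≫ e.inv = 𝟙 X := by
      rw [← Preadditive.comp_sum, ← Preadditive.sum_comp, h]
      simp
    rw [← h2]
    exact Finset.sum_congr rfl fun j _ => by simp

/-- A chosen decomposition. The algebra below does not depend on the choice. -/
def decomposition [FiniteSemisimple C] (I : Irr C) (X : C) : Decomposition I X :=
  (nonempty_decomposition I X).some

end Decomposition

/-! ### The Kitaev–Kong algebra -/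

section Algebra

set_option linter.unusedSectionVars false

variable {C : Type u₁} [Category.{v₁} C] [Abelian C] [Linear ℂ C] [FiniteSemisimple C]
  [MonoidalCategory C] [MonoidalPreadditive C] [MonoidalLinear ℂ C]
variable {M : Type u₂} [Category.{v₂} M] [Abelian M] [Linear ℂ M]
  [MonoidalLeftAction C M] [LinearAction C M]
variable {N : Type u₃} [Category.{v₃} N] [Abelian N] [Linear ℂ N]
  [MonoidalLeftAction C N] [LinearAction C N]

/-- `⨁_{x ∈ Irr(C)} N(n₁, x ⊙ n₂) ⊗ M(x ⊙ m₂, m₁)`; the finite direct sum is realised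
as the type of families indexed by `Irr(C)`. -/
abbrev Block (I : Irr C) (m₁ : M) (n₁ : N) (m₂ : M) (n₂ : N) : Type (max v₂ v₃) :=
  ∀ x : Fin I.card, (n₁ ⟶ I.obj x ⊙ₗ n₂) ⊗[ℂ] (I.obj x ⊙ₗ m₂ ⟶ m₁)

/-- For `f : n₁ ⟶ X ⊙ n₂` and `g : X ⊙ m₂ ⟶ m₁` with `X` an arbitrary object
of `C`, the element `∑ⱼ (πⱼ ∘ f) ⊗ (g ∘ ιⱼ)` of the block, where `(πⱼ, ιⱼ)` decomposes `X` into
simple objects. -/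
def cls (I : Irr C) (X : C) {m₁ : M} {n₁ : N} {m₂ : M} {n₂ : N} :
    (n₁ ⟶ X ⊙ₗ n₂) →ₗ[ℂ] (X ⊙ₗ m₂ ⟶ m₁) →ₗ[ℂ] Block I m₁ n₁ m₂ n₂ :=
  LinearMap.mk₂ ℂ
    (fun f g => ∑ j, Pi.single ((decomposition I X).label j)
      ((f ≫ (decomposition I X).π j ⊵ₗ n₂) ⊗ₜ[ℂ] ((decomposition I X).ι j ⊵ₗ m₂ ≫ g)))
    (fun f f' g => by
      simp [Preadditive.add_comp, TensorProduct.add_tmul, Pi.single_add, Finset.sum_add_distrib])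
    (fun r f g => by
      rw [Finset.smul_sum]
      refine Finset.sum_congr rfl fun j _ => ?_
      rw [Linear.smul_comp, ← TensorProduct.smul_tmul', Pi.single_smul])
    (fun f g g' => by
      simp [Preadditive.comp_add, TensorProduct.tmul_add, Pi.single_add, Finset.sum_add_distrib])
    (fun r f g => by
      simp [Linear.comp_smul, TensorProduct.tmul_smul, Pi.single_smul, Finset.smul_sum])

/-- `n₁ ⟶ X ⊙ n₂ ⟶ X ⊙ (Y ⊙ n₃) ≅ (X ⊗ Y) ⊙ n₃`. -/
def compN (X Y : C) {n₁ n₂ n₃ : N} :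
    (n₁ ⟶ X ⊙ₗ n₂) →ₗ[ℂ] (n₂ ⟶ Y ⊙ₗ n₃) →ₗ[ℂ] (n₁ ⟶ (X ⊗ Y) ⊙ₗ n₃) :=
  LinearMap.mk₂ ℂ (fun f f' => f ≫ X ⊴ₗ f' ≫ (αₗ X Y n₃).inv)
    (fun f f' g => by simp [Preadditive.add_comp])
    (fun r f g => by simp [Linear.smul_comp])
    (fun f g g' => by
      simp [LinearAction.right_add, Preadditive.add_comp, Preadditive.comp_add])
    (fun r f g => by
      simp [LinearAction.right_smul, Linear.smul_comp, Linear.comp_smul])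

/-- `(X ⊗ Y) ⊙ m₃ ≅ X ⊙ (Y ⊙ m₃) ⟶ X ⊙ m₂ ⟶ m₁`. -/
def compM (X Y : C) {m₁ m₂ m₃ : M} :
    (X ⊙ₗ m₂ ⟶ m₁) →ₗ[ℂ] (Y ⊙ₗ m₃ ⟶ m₂) →ₗ[ℂ] ((X ⊗ Y) ⊙ₗ m₃ ⟶ m₁) :=
  LinearMap.mk₂ ℂ (fun g g' => (αₗ X Y m₃).hom ≫ X ⊴ₗ g' ≫ g)
    (fun f f' g => by simp [Preadditive.comp_add])
    (fun r f g => by simp [Linear.comp_smul])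
    (fun f g g' => by
      simp [LinearAction.right_add, Preadditive.add_comp, Preadditive.comp_add])
    (fun r f g => by
      simp [LinearAction.right_smul, Linear.smul_comp, Linear.comp_smul])

/-- The multiplication of blocks: `(f ⊗ g) · (f' ⊗ g')` for `f ⊗ g` in the summand of `x` and
`f' ⊗ g'` in the summand of `y` is obtained by composing to morphisms
`n₁ ⟶ (x ⊗ y) ⊙ n₃` and `(x ⊗ y) ⊙ m₃ ⟶ m₁` and decomposing `x ⊗ y` into simple objects. -/
def blockMul (I : Irr C) {m₁ : M} {n₁ : N} {m₂ : M} {n₂ : N} {m₃ : M} {n₃ : N} :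
    Block I m₁ n₁ m₂ n₂ →ₗ[ℂ] Block I m₂ n₂ m₃ n₃ →ₗ[ℂ] Block I m₁ n₁ m₃ n₃ :=
  ∑ x : Fin I.card, ∑ y : Fin I.card,
    ((TensorProduct.map₂ (compN (I.obj x) (I.obj y) (n₁ := n₁) (n₂ := n₂) (n₃ := n₃))
      (compM (I.obj x) (I.obj y) (m₁ := m₁) (m₂ := m₂) (m₃ := m₃))).compr₂
      (TensorProduct.lift (cls I (I.obj x ⊗ I.obj y)))).compl₁₂
      (LinearMap.proj x) (LinearMap.proj y)

/-- The unit: `n ≅ 𝟙 ⊙ n` and `𝟙 ⊙ m ≅ m`, with `𝟙` decomposed into simple objects. -/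
def blockOne (I : Irr C) (m : M) (n : N) : Block I m n m n :=
  cls I (𝟙_ C) (λₗ n).inv (λₗ m).hom

theorem zero_action {X Y : C} (m : M) : (0 : X ⟶ Y) ⊵ₗ m = 0 := by
  simpa using LinearAction.left_smul (0 : ℂ) (0 : X ⟶ Y) m

theorem sum_action {X Y : C} {J : Type*} (s : Finset J) (f : J → (X ⟶ Y)) (m : M) :
    (∑ j ∈ s, f j) ⊵ₗ m = ∑ j ∈ s, f j ⊵ₗ m := by
  classical
  induction s using Finset.induction_on with
  | empty => simpa using zero_action m
  | insert a s h ih => simp [Finset.sum_insert h, LinearAction.left_add, ih]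

theorem single_slide (I : Irr C) {m₁ : M} {n₁ : N} {m₂ : M} {n₂ : N} (a b : Fin I.card)
    (s : I.obj a ⟶ I.obj b) (f : n₁ ⟶ I.obj a ⊙ₗ n₂) (g : I.obj b ⊙ₗ m₂ ⟶ m₁) :
    (Pi.single b ((f ≫ s ⊵ₗ n₂) ⊗ₜ[ℂ] g) : Block I m₁ n₁ m₂ n₂) =
      Pi.single a (f ⊗ₜ[ℂ] (s ⊵ₗ m₂ ≫ g)) := by
  have := I.simple a
  have := I.simple b
  by_cases h : a = b
  · subst h
    have := FiniteSemisimple.finite_hom (I.obj a) (I.obj a)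
    obtain ⟨c, rfl⟩ := endomorphism_simple_eq_smul_id ℂ s
    simp [LinearAction.left_smul, Linear.comp_smul, Linear.smul_comp, TensorProduct.smul_tmul]
  · have hs : s = 0 := by
      by_contra hs
      have := isIso_of_hom_simple hs
      exact h (I.eq_of_iso a b ⟨asIso s⟩)
    subst hs
    simp [zero_action]

theorem cls_apply (I : Irr C) (X : C) {m₁ : M} {n₁ : N} {m₂ : M} {n₂ : N}
    (f : n₁ ⟶ X ⊙ₗ n₂) (g : X ⊙ₗ m₂ ⟶ m₁) :
    cls I X f g = ∑ j, Pi.single ((decomposition I X).label j)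
      ((f ≫ (decomposition I X).π j ⊵ₗ n₂) ⊗ₜ[ℂ] ((decomposition I X).ι j ⊵ₗ m₂ ≫ g)) := rfl

/-- Dinaturality of `cls`. In particular `cls` is independent of the chosen decompositions. -/
theorem cls_slide (I : Irr C) {X Y : C} {m₁ : M} {n₁ : N} {m₂ : M} {n₂ : N}
    (h : X ⟶ Y) (f : n₁ ⟶ X ⊙ₗ n₂) (g : Y ⊙ₗ m₂ ⟶ m₁) :
    cls I Y (f ≫ h ⊵ₗ n₂) g = cls I X f (h ⊵ₗ m₂ ≫ g) := by
  set D := decomposition I X with hD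
  set E := decomposition I Y with hE
  have h1 : ∀ k, h ≫ E.π k = ∑ j, D.π j ≫ D.ι j ≫ h ≫ E.π k := fun k => by
    have := congrArg (· ≫ h ≫ E.π k) D.sum_π_ι
    simpa [Preadditive.sum_comp] using this.symm
  have h2 : ∀ j, D.ι j ≫ h = ∑ k, (D.ι j ≫ h ≫ E.π k) ≫ E.ι k := fun j => by
    have := congrArg (fun t => (D.ι j ≫ h) ≫ t) E.sum_π_ι
    simpa [Preadditive.comp_sum] using this.symm
  have e1 : ∀ k, (f ≫ h ⊵ₗ n₂) ≫ E.π k ⊵ₗ n₂ =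
      ∑ j, (f ≫ D.π j ⊵ₗ n₂) ≫ (D.ι j ≫ h ≫ E.π k) ⊵ₗ n₂ := fun k => by
    conv_lhs => rw [Category.assoc, ← comp_actionHomLeft, h1, sum_action, Preadditive.comp_sum]
    exact Finset.sum_congr rfl fun j _ => by
      rw [comp_actionHomLeft, Category.assoc]
  have e2 : ∀ j, D.ι j ⊵ₗ m₂ ≫ h ⊵ₗ m₂ ≫ g =
      ∑ k, (D.ι j ≫ h ≫ E.π k) ⊵ₗ m₂ ≫ E.ι k ⊵ₗ m₂ ≫ g := fun j => by
    rw [← Category.assoc, ← comp_actionHomLeft, h2, sum_action, Preadditive.sum_comp]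
    exact Finset.sum_congr rfl fun k _ => by rw [comp_actionHomLeft, Category.assoc]
  rw [cls_apply, cls_apply, ← hD, ← hE]
  have l : ∀ k, (Pi.single (E.label k) (((f ≫ h ⊵ₗ n₂) ≫ E.π k ⊵ₗ n₂) ⊗ₜ[ℂ]
      (E.ι k ⊵ₗ m₂ ≫ g)) : Block I m₁ n₁ m₂ n₂) =
      ∑ j, Pi.single (D.label j) ((f ≫ D.π j ⊵ₗ n₂) ⊗ₜ[ℂ]
        ((D.ι j ≫ h ≫ E.π k) ⊵ₗ m₂ ≫ E.ι k ⊵ₗ m₂ ≫ g)) := fun k => by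
    rw [e1, TensorProduct.sum_tmul]
    simp only [← single_slide]
    exact map_sum (LinearMap.single ℂ _ (E.label k)) _ _
  have r : ∀ j, (Pi.single (D.label j) ((f ≫ D.π j ⊵ₗ n₂) ⊗ₜ[ℂ]
      (D.ι j ⊵ₗ m₂ ≫ h ⊵ₗ m₂ ≫ g)) : Block I m₁ n₁ m₂ n₂) =
      ∑ k, Pi.single (D.label j) ((f ≫ D.π j ⊵ₗ n₂) ⊗ₜ[ℂ]
        ((D.ι j ≫ h ≫ E.π k) ⊵ₗ m₂ ≫ E.ι k ⊵ₗ m₂ ≫ g)) := fun j => by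
    rw [e2, TensorProduct.tmul_sum]
    exact map_sum (LinearMap.single ℂ _ (D.label j)) _ _
  simp only [l, r]
  exact Finset.sum_comm

theorem cls_obj (I : Irr C) (x : Fin I.card) {m₁ : M} {n₁ : N} {m₂ : M} {n₂ : N}
    (f : n₁ ⟶ I.obj x ⊙ₗ n₂) (g : I.obj x ⊙ₗ m₂ ⟶ m₁) :
    cls I (I.obj x) f g = Pi.single x (f ⊗ₜ[ℂ] g) := by
  rw [cls_apply]
  simp only [single_slide]
  have : ∀ (D : Decomposition I (I.obj x)),
      ∑ j, (Pi.single x (f ⊗ₜ[ℂ] (D.π j ⊵ₗ m₂ ≫ D.ι j ⊵ₗ m₂ ≫ g)) : Block I m₁ n₁ m₂ n₂) =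
        Pi.single x (f ⊗ₜ[ℂ] g) := fun D => by
    have e : ∑ j, (D.π j ⊵ₗ m₂ ≫ D.ι j ⊵ₗ m₂ ≫ g) = g := by
      have := congrArg (fun t => t ⊵ₗ m₂ ≫ g) D.sum_π_ι
      simpa [sum_action, Preadditive.sum_comp] using this
    conv_rhs => rw [← e, TensorProduct.tmul_sum]
    exact (map_sum (LinearMap.single ℂ _ x) _ _).symm
  exact this _

theorem block_induction (I : Irr C) {m₁ : M} {n₁ : N} {m₂ : M} {n₂ : N}
    {p : Block I m₁ n₁ m₂ n₂ → Prop} (h0 : p 0) (hadd : ∀ a b, p a → p b → p (a + b))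
    (hcls : ∀ (X : C) (f : n₁ ⟶ X ⊙ₗ n₂) (g : X ⊙ₗ m₂ ⟶ m₁), p (cls I X f g))
    (a : Block I m₁ n₁ m₂ n₂) : p a := by
  classical
  have hs : ∀ (x : Fin I.card) (t : (n₁ ⟶ I.obj x ⊙ₗ n₂) ⊗[ℂ] (I.obj x ⊙ₗ m₂ ⟶ m₁)),
      p (Pi.single x t) := fun x t => by
    induction t using TensorProduct.induction_on with
    | zero => simpa using h0
    | tmul f g => rw [← cls_obj]; exact hcls _ f g
    | add s t hs ht => rw [Pi.single_add]; exact hadd _ _ hs ht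
  rw [← Finset.univ_sum_single a]
  exact Finset.sum_induction _ p hadd h0 fun x _ => hs x _

theorem blockMul_single (I : Irr C) {m₁ : M} {n₁ : N} {m₂ : M} {n₂ : N} {m₃ : M} {n₃ : N}
    (x y : Fin I.card) (f : n₁ ⟶ I.obj x ⊙ₗ n₂) (g : I.obj x ⊙ₗ m₂ ⟶ m₁)
    (f' : n₂ ⟶ I.obj y ⊙ₗ n₃) (g' : I.obj y ⊙ₗ m₃ ⟶ m₂) :
    blockMul I (Pi.single x (f ⊗ₜ[ℂ] g)) (Pi.single y (f' ⊗ₜ[ℂ] g')) =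
      cls I (I.obj x ⊗ I.obj y) (compN _ _ f f') (compM _ _ g g') := by
  unfold blockMul
  simp only [LinearMap.sum_apply, LinearMap.compl₁₂_apply, LinearMap.proj_apply,
    LinearMap.compr₂_apply]
  rw [Finset.sum_eq_single x, Finset.sum_eq_single y]
  · simp
  · intro b _ hb; simp [Pi.single_eq_of_ne hb]
  · simp
  · intro b _ hb; simp [Pi.single_eq_of_ne hb]
  · simp

theorem blockMul_cls (I : Irr C) {m₁ : M} {n₁ : N} {m₂ : M} {n₂ : N} {m₃ : M} {n₃ : N}
    (X Y : C) (f : n₁ ⟶ X ⊙ₗ n₂) (g : X ⊙ₗ m₂ ⟶ m₁)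
    (f' : n₂ ⟶ Y ⊙ₗ n₃) (g' : Y ⊙ₗ m₃ ⟶ m₂) :
    blockMul I (cls I X f g) (cls I Y f' g') =
      cls I (X ⊗ Y) (compN _ _ f f') (compM _ _ g g') := by
  set D := decomposition I X with hD
  set E := decomposition I Y with hE
  rw [cls_apply I X, cls_apply I Y, ← hD, ← hE]
  simp only [map_sum, LinearMap.sum_apply, blockMul_single]
  have hN : ∀ j k, compN _ _ (f ≫ D.π j ⊵ₗ n₂) (f' ≫ E.π k ⊵ₗ n₃) =
      compN X Y f f' ≫ (D.π j ⊗ₘ E.π k) ⊵ₗ n₃ := fun j k => by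
    simp only [compN, LinearMap.mk₂_apply, Category.assoc]
    have := actionAssocIso_inv_naturality (D.π j) (E.π k) (𝟙 n₃)
    simp only [actionHom_id] at this
    rw [← this, actionHom_def']
    simp only [actionHomRight_comp, Category.assoc]
    rw [action_exchange_assoc, action_exchange_assoc]
  have hM : ∀ j k, compM _ _ (D.ι j ⊵ₗ m₂ ≫ g) (E.ι k ⊵ₗ m₃ ≫ g') =
      (D.ι j ⊗ₘ E.ι k) ⊵ₗ m₃ ≫ compM X Y g g' := fun j k => by
    simp only [compM, LinearMap.mk₂_apply]
    have := actionAssocIso_hom_naturality (D.ι j) (E.ι k) (𝟙 m₃)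
    simp only [actionHom_id] at this
    rw [reassoc_of% this, actionHom_def']
    simp only [actionHomRight_comp, Category.assoc]
    rw [action_exchange_assoc]
  simp only [hN, hM, cls_slide]
  rw [Finset.sum_comm]
  simp only [← map_sum]
  congr 1
  have := congrArg₂ (fun s t => (s ⊗ₘ t) ⊵ₗ m₃ ≫ compM X Y g g') D.sum_π_ι E.sum_π_ι
  simp only [id_tensorHom_id, id_actionHomLeft, Category.id_comp] at this
  refine Eq.trans ?_ this
  simp only [sum_tensor, tensor_sum, sum_action, Preadditive.sum_comp,
    ← comp_actionHomLeft_assoc, tensorHom_comp_tensorHom]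
  try rw [Finset.sum_comm]

theorem blockMul_assoc (I : Irr C) {m₁ m₂ m₃ m₄ : M} {n₁ n₂ n₃ n₄ : N}
    (a : Block I m₁ n₁ m₂ n₂) (b : Block I m₂ n₂ m₃ n₃) (c : Block I m₃ n₃ m₄ n₄) :
    blockMul I (blockMul I a b) c = blockMul I a (blockMul I b c) := by
  induction a using block_induction with
  | h0 => simp
  | hadd a a' h h' => simp [h, h']
  | hcls X f g =>
  induction b using block_induction with
  | h0 => simp
  | hadd a a' h h' => simp [h, h']
  | hcls Y f' g' =>
  induction c using block_induction with
  | h0 => simp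
  | hadd a a' h h' => simp [h, h']
  | hcls Z f'' g'' =>
  simp only [blockMul_cls]
  have e : compM (X ⊗ Y) Z (compM X Y g g') g'' =
      (α_ X Y Z).hom ⊵ₗ m₄ ≫ compM X (Y ⊗ Z) g (compM Y Z g' g'') := by
    simp [compM]
  rw [e, ← cls_slide]
  congr 2
  have p : (αₗ X Y (Z ⊙ₗ n₄)).inv ≫ (αₗ (X ⊗ Y) Z n₄).inv ≫ (α_ X Y Z).hom ⊵ₗ n₄ =
      X ⊴ₗ (αₗ Y Z n₄).inv ≫ (αₗ X (Y ⊗ Z) n₄).inv := by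
    rw [Iso.inv_comp_eq, Iso.inv_comp_eq, ← cancel_mono ((αₗ X (Y ⊗ Z) n₄).hom),
      ← cancel_mono (X ⊴ₗ (αₗ Y Z n₄).hom)]
    simp
  simp [compN, p]

theorem blockOne_mul (I : Irr C) {m₁ m₂ : M} {n₁ n₂ : N} (a : Block I m₁ n₁ m₂ n₂) :
    blockMul I (blockOne I m₁ n₁) a = a := by
  induction a using block_induction with
  | h0 => simp
  | hadd a a' h h' => simp [h, h']
  | hcls X f g =>
  rw [blockOne, blockMul_cls]
  have e : compM (𝟙_ C) X (λₗ m₁).hom g = (λ_ X).hom ⊵ₗ m₂ ≫ g := by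
    simp [compM]
  rw [e, ← cls_slide]
  congr 2
  simp [compN]

theorem blockMul_one (I : Irr C) {m₁ m₂ : M} {n₁ n₂ : N} (a : Block I m₁ n₁ m₂ n₂) :
    blockMul I a (blockOne I m₂ n₂) = a := by
  induction a using block_induction with
  | h0 => simp
  | hadd a a' h h' => simp [h, h']
  | hcls X f g =>
  rw [blockOne, blockMul_cls]
  have e : compM X (𝟙_ C) g (λₗ m₂).hom = (ρ_ X).hom ⊵ₗ m₂ ≫ g := by
    simp [compM]
  rw [e, ← cls_slide]
  congr 2
  simp [compN]

/-- The underlying space of the Kitaev–Kong algebra,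
`⨁ N(n₁, c ⊙ n₂) ⊗ M(c ⊙ m₂, m₁)` over `c ∈ Irr(C)`, `m₁, m₂ ∈ Irr(M)`, `n₁, n₂ ∈ Irr(N)`. An
element is a square matrix with rows and columns indexed by `Irr(M) × Irr(N)`, whose entry at
`((m₁, n₁), (m₂, n₂))` lies in the block `⨁_c N(n₁, c ⊙ n₂) ⊗ M(c ⊙ m₂, m₁)`. -/
def KKAlgebra (I : Irr C) (J : Irr M) (K : Irr N) : Type (max v₂ v₃) :=
  ∀ p q : Fin J.card × Fin K.card,
    Block I (J.obj p.1) (K.obj p.2) (J.obj q.1) (K.obj q.2)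

namespace KKAlgebra

variable (I : Irr C) (J : Irr M) (K : Irr N)

instance : AddCommGroup (KKAlgebra I J K) :=
  inferInstanceAs (AddCommGroup (∀ p q : Fin J.card × Fin K.card,
    Block I (J.obj p.1) (K.obj p.2) (J.obj q.1) (K.obj q.2)))

instance : Module ℂ (KKAlgebra I J K) :=
  inferInstanceAs (Module ℂ (∀ p q : Fin J.card × Fin K.card,
    Block I (J.obj p.1) (K.obj p.2) (J.obj q.1) (K.obj q.2)))

/-- Matrix multiplication, with entries multiplied by `blockMul`. -/
instance : Mul (KKAlgebra I J K) where
  mul a b := fun p r => ∑ q, blockMul I (a p q) (b q r)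

/-- The identity matrix, with diagonal entries `blockOne`. -/
instance : One (KKAlgebra I J K) where
  one := fun p => Pi.single p (blockOne I (J.obj p.1) (K.obj p.2))

variable {I J K}

theorem mul_apply (a b : KKAlgebra I J K) (p r : Fin J.card × Fin K.card) :
    (a * b) p r = ∑ q, blockMul I (a p q) (b q r) := rfl

theorem one_apply_self (p : Fin J.card × Fin K.card) :
    (1 : KKAlgebra I J K) p p = blockOne I (J.obj p.1) (K.obj p.2) :=
  Pi.single_eq_same p _

theorem one_apply_ne {p q : Fin J.card × Fin K.card} (h : p ≠ q) :
    (1 : KKAlgebra I J K) p q = 0 :=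
  Pi.single_eq_of_ne h.symm _

theorem add_apply (a b : KKAlgebra I J K) (p r : Fin J.card × Fin K.card) :
    (a + b) p r = a p r + b p r := rfl

theorem smul_apply (c : ℂ) (a : KKAlgebra I J K) (p r : Fin J.card × Fin K.card) :
    (c • a) p r = c • a p r := rfl

theorem zero_apply (p r : Fin J.card × Fin K.card) : (0 : KKAlgebra I J K) p r = 0 := rfl

@[ext]
theorem ext {a b : KKAlgebra I J K} (h : ∀ p q, a p q = b p q) : a = b :=
  funext fun p => funext fun q => h p q

instance : Ring (KKAlgebra I J K) where
  __ := (inferInstance : AddCommGroup (KKAlgebra I J K))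
  left_distrib a b c := by
    ext1 p r
    simp only [mul_apply, add_apply, map_add, Finset.sum_add_distrib]
  right_distrib a b c := by
    ext1 p r
    simp only [mul_apply, add_apply, map_add, LinearMap.add_apply, Finset.sum_add_distrib]
  zero_mul a := by
    ext1 p r
    simp only [mul_apply, zero_apply, map_zero, LinearMap.zero_apply, Finset.sum_const_zero]
  mul_zero a := by
    ext1 p r
    simp only [mul_apply, zero_apply, map_zero, Finset.sum_const_zero]
  mul_assoc a b c := by
    ext1 p r
    simp only [mul_apply, map_sum, LinearMap.sum_apply, blockMul_assoc]
    exact Finset.sum_comm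
  one_mul a := by
    ext1 p r
    rw [mul_apply, Finset.sum_eq_single p, one_apply_self, blockOne_mul]
    · intro q _ h
      rw [one_apply_ne h.symm, map_zero, LinearMap.zero_apply]
    · simp
  mul_one a := by
    ext1 p r
    rw [mul_apply, Finset.sum_eq_single r, one_apply_self, blockMul_one]
    · intro q _ h
      rw [one_apply_ne h, map_zero]
    · simp

instance : Algebra ℂ (KKAlgebra I J K) :=
  Algebra.ofModule
    (fun c a b => by
      ext1 p r
      simp only [mul_apply, smul_apply, map_smul, LinearMap.smul_apply, Finset.smul_sum])
    (fun c a b => by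
      ext1 p r
      simp only [mul_apply, smul_apply, map_smul, Finset.smul_sum])

end KKAlgebra

end Algebra

/-! ### Finite-dimensional representations -/

/-- `rep(A)`: the category of finite-dimensional left modules over a `ℂ`-algebra `A`, where `ℂ`
acts through `ℂ → A`. It is a full subcategory of `ModuleCat A`, whose `ℂ`-linear structure is
`ModuleCat.linearOverField`. -/
def finiteDimensional (A : Type*) [Ring A] [Algebra ℂ A] : ObjectProperty (ModuleCat.{w} A) :=
  fun V => @FiniteDimensional ℂ V _ _ (ModuleCat.moduleOfAlgebraModule V)

/-- `rep(A)`. -/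
abbrev Rep (A : Type*) [Ring A] [Algebra ℂ A] := (finiteDimensional.{w} A).FullSubcategory

/-! ### Lax and strong module functors -/

section ModuleFunctor

variable (C : Type u₁) [Category.{v₁} C] [MonoidalCategory C]
variable (M : Type u₂) [Category.{v₂} M] [Preadditive M] [Linear ℂ M] [MonoidalLeftAction C M]
variable (N : Type u₃) [Category.{v₃} N] [Preadditive N] [Linear ℂ N] [MonoidalLeftAction C N]

/-- A lax `C`-module functor: a `ℂ`-linear functor `F` with coherent natural morphisms
`c ⊙ F(m) ⟶ F(c ⊙ m)`. -/
structure LaxModuleFunctor where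
  toFunctor : M ⥤ N
  [additive : toFunctor.Additive]
  [linear : toFunctor.Linear ℂ]
  [lax : toFunctor.LaxLeftLinear C]

variable {C M N}

namespace LaxModuleFunctor

attribute [instance] additive linear lax

/-- The structure morphism `c ⊙ F(m) ⟶ F(c ⊙ m)`. -/
abbrev μ (F : LaxModuleFunctor C M N) (c : C) (m : M) :
    c ⊙ₗ F.toFunctor.obj m ⟶ F.toFunctor.obj (c ⊙ₗ m) :=
  Functor.LaxLeftLinear.μₗ F.toFunctor c m

/-- A morphism of lax module functors: a natural transformation compatible with the structure
morphisms. -/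
@[ext]
structure Hom (F G : LaxModuleFunctor C M N) where
  nat : F.toFunctor ⟶ G.toFunctor
  comm : ∀ (c : C) (m : M), F.μ c m ≫ nat.app (c ⊙ₗ m) = c ⊴ₗ nat.app m ≫ G.μ c m

instance : Category (LaxModuleFunctor C M N) where
  Hom F G := Hom F G
  id F := ⟨𝟙 _, fun c m => by simp⟩
  comp f g := ⟨f.nat ≫ g.nat, fun c m => by
    simp only [NatTrans.comp_app, actionHomRight_comp, Category.assoc]
    rw [← g.comm, ← Category.assoc, f.comm, Category.assoc]⟩

@[ext]
theorem hom_ext {F G : LaxModuleFunctor C M N} {f g : F ⟶ G} (h : f.nat = g.nat) : f = g :=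
  Hom.ext h

@[simp] theorem id_nat (F : LaxModuleFunctor C M N) : Hom.nat (𝟙 F) = 𝟙 F.toFunctor := rfl

@[simp] theorem comp_nat {F G H : LaxModuleFunctor C M N} (f : F ⟶ G) (g : G ⟶ H) :
    Hom.nat (f ≫ g) = f.nat ≫ g.nat := rfl

end LaxModuleFunctor

end ModuleFunctor

section Linear

variable {C : Type u₁} [Category.{v₁} C] [Abelian C] [Linear ℂ C] [MonoidalCategory C]
variable {M : Type u₂} [Category.{v₂} M] [Abelian M] [Linear ℂ M] [MonoidalLeftAction C M]
variable {N : Type u₃} [Category.{v₃} N] [Abelian N] [Linear ℂ N] [MonoidalLeftAction C N]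
  [LinearAction C N]

namespace LaxModuleFunctor

/-- Compatible natural transformations form a subspace of all natural transformations. -/
def homSubmodule (F G : LaxModuleFunctor C M N) : Submodule ℂ (F.toFunctor ⟶ G.toFunctor) where
  carrier := {f | ∀ (c : C) (m : M), F.μ c m ≫ f.app (c ⊙ₗ m) = c ⊴ₗ f.app m ≫ G.μ c m}
  add_mem' hf hg c m := by
    simp [Preadditive.comp_add, Preadditive.add_comp, LinearAction.right_add, hf c m, hg c m]
  zero_mem' c m := by
    have : c ⊴ₗ (0 : F.toFunctor.obj m ⟶ G.toFunctor.obj m) = 0 := by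
      simpa using LinearAction.right_smul c (0 : ℂ) (0 : F.toFunctor.obj m ⟶ G.toFunctor.obj m)
    simp [this]
  smul_mem' r f hf c m := by
    simp [LinearAction.right_smul, hf c m]

/-- A morphism of lax module functors as an element of `homSubmodule`. -/
def homEquiv (F G : LaxModuleFunctor C M N) : (F ⟶ G) ≃ homSubmodule F G where
  toFun f := ⟨f.nat, f.comm⟩
  invFun f := ⟨f.1, f.2⟩
  left_inv _ := rfl
  right_inv _ := rfl

instance (F G : LaxModuleFunctor C M N) : AddCommGroup (F ⟶ G) := (homEquiv F G).addCommGroup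

instance (F G : LaxModuleFunctor C M N) : Module ℂ (F ⟶ G) := (homEquiv F G).module ℂ

@[simp] theorem add_nat {F G : LaxModuleFunctor C M N} (f g : F ⟶ G) :
    (f + g).nat = f.nat + g.nat := rfl

@[simp] theorem smul_nat {F G : LaxModuleFunctor C M N} (r : ℂ) (f : F ⟶ G) :
    (r • f).nat = r • f.nat := rfl

instance : Preadditive (LaxModuleFunctor C M N) where
  add_comp _ _ _ _ _ _ := by ext1; simp [Preadditive.add_comp]
  comp_add _ _ _ _ _ _ := by ext1; simp [Preadditive.comp_add]

instance : Linear ℂ (LaxModuleFunctor C M N) where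
  homModule := inferInstance
  smul_comp _ _ _ _ _ _ := by ext1; simp [Linear.smul_comp]
  comp_smul _ _ _ _ _ _ := by ext1; simp [Linear.comp_smul]

end LaxModuleFunctor

end Linear

section Strong

variable (C : Type u₁) [Category.{v₁} C] [MonoidalCategory C]
variable (M : Type u₂) [Category.{v₂} M] [Preadditive M] [Linear ℂ M] [MonoidalLeftAction C M]
variable (N : Type u₃) [Category.{v₃} N] [Preadditive N] [Linear ℂ N] [MonoidalLeftAction C N]

/-- A lax module functor is strong if its structure morphisms `c ⊙ F(m) ⟶ F(c ⊙ m)` are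
isomorphisms. -/
def strong : ObjectProperty (LaxModuleFunctor C M N) :=
  fun F => ∀ (c : C) (m : M), IsIso (F.μ c m)

/-- The category of (strong) `C`-module functors and module natural transformations. -/
abbrev StrongModuleFunctor := (strong C M N).FullSubcategory

end Strong

end

end KitaevKong

/-! Blocks make sense for all pairs `(m, n)`, not only simple ones. The block between `(m₁, n₁)` and
`(m₂, n₂)` plays the role of the coend over `X` in `C` of `N(n₁, X ⊙ n₂) ⊗ M(X ⊙ m₂, m₁)`, with
`cls` as its dinatural family. With `blockMul` and `blockOne` the pairs thus form a linear category
whose restriction to simple pairs is the Kitaev–Kong algebra `A`. A `BlockModule` is a module over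
this category.

Blocks are generated by morphisms of `N` (`pull`), morphisms of `M` (`push`) and tautological
elements (`str`); see `cls_eq_mul`. So a block module is a bifunctor `P(m, n)`, covariant in `m` and
contravariant in `n`, with coherent maps `P(m, n) → P(X ⊙ m, X ⊙ n)`. If its spaces are
finite-dimensional, semisimplicity of `N` makes each `P(m, -)` representable by an object `R(m)`
(`exists_isUniversal`), and by Yoneda the maps `str` become a lax module structure on `R`.
Conversely a lax module functor `F` gives the block module `N(n, F(m))`.

The equivalence sends `F` to the sum of the spaces `N(n, F(m))` over simple pairs. It is fully
faithful because every identity factors through simple pairs (`exists_sum_eq_blockOne`), so an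
`A`-linear map extends to all pairs (`exists_extension`), and Yoneda turns the extension into a
module transformation. It is essentially surjective because an `A`-module `W` is the restriction of
its coinduced block module (`toCoinduced_bijective`), which is representable.

In the rigid case every lax structure morphism is invertible (`isIso_μ`): its inverse is built from
the structure morphism for the dual object, coevaluation and evaluation. So lax and strong module
functors coincide. -/

namespace KitaevKong

open scoped TensorProduct

noncomputable section

attribute [local instance] Abelian.hasFiniteBiproducts

set_option linter.unusedSectionVars false

/-! ### Generators of the blocks and their relations -/

section BlockModules

variable {C : Type u₁} [Category.{v₁} C] [Abelian C] [Linear ℂ C] [FiniteSemisimple C]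
  [MonoidalCategory C] [MonoidalPreadditive C] [MonoidalLinear ℂ C]
variable {M : Type u₂} [Category.{v₂} M] [Abelian M] [Linear ℂ M]
  [MonoidalLeftAction C M] [LinearAction C M]
variable {N : Type u₃} [Category.{v₃} N] [Abelian N] [Linear ℂ N]
  [MonoidalLeftAction C N] [LinearAction C N]

/-- The element of the block of `(m, n)` and `(m, n')` given by a morphism `n ⟶ n'`. -/
def pullBlock (I : Irr C) (m : M) {n n' : N} (h : n ⟶ n') : Block I m n m n' :=
  cls I (𝟙_ C) (h ≫ (λₗ n').inv) (λₗ m).hom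

/-- The element of the block of `(m', n)` and `(m, n)` given by a morphism `m ⟶ m'`. -/
def pushBlock (I : Irr C) {m m' : M} (n : N) (g : m ⟶ m') : Block I m' n m n :=
  cls I (𝟙_ C) (λₗ n).inv ((λₗ m).hom ≫ g)

/-- The tautological element of the block of `(X ⊙ m, X ⊙ n)` and `(m, n)`. -/
def strBlock (I : Irr C) (X : C) (m : M) (n : N) : Block I (X ⊙ₗ m) (X ⊙ₗ n) m n :=
  cls I X (𝟙 _) (𝟙 _)

/-- The product lives over `𝟙_ C ⊗ X`; sliding along the left unitor by `cls_slide` brings it back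
to `X`. The three analogues below work the same way, with the right unitor for multiplication from
the right. -/
theorem pullBlock_mul_cls (I : Irr C) (X : C) {m₁ m₂ : M} {n n₁ n₂ : N} (h : n ⟶ n₁)
    (f : n₁ ⟶ X ⊙ₗ n₂) (g : X ⊙ₗ m₂ ⟶ m₁) :
    blockMul I (pullBlock I m₁ h) (cls I X f g) = cls I X (h ≫ f) g := by
  rw [pullBlock, blockMul_cls]
  have e : compM (𝟙_ C) X (λₗ m₁).hom g = (λ_ X).hom ⊵ₗ m₂ ≫ g := by
    simp [compM]
  rw [e, ← cls_slide]
  congr 2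
  simp [compN]

theorem pushBlock_mul_cls (I : Irr C) (X : C) {m m₁ m₂ : M} {n₁ n₂ : N}
    (f : n₁ ⟶ X ⊙ₗ n₂) (g : X ⊙ₗ m₂ ⟶ m₁) (k : m₁ ⟶ m) :
    blockMul I (pushBlock I n₁ k) (cls I X f g) = cls I X f (g ≫ k) := by
  rw [pushBlock, blockMul_cls]
  have e : compM (𝟙_ C) X ((λₗ m₁).hom ≫ k) g = (λ_ X).hom ⊵ₗ m₂ ≫ g ≫ k := by
    simp [compM]
  rw [e, ← cls_slide]
  congr 2
  simp [compN]

theorem cls_mul_pullBlock (I : Irr C) (X : C) {m₁ m₂ : M} {n₁ n₂ n₃ : N}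
    (f : n₁ ⟶ X ⊙ₗ n₂) (g : X ⊙ₗ m₂ ⟶ m₁) (h : n₂ ⟶ n₃) :
    blockMul I (cls I X f g) (pullBlock I m₂ h) = cls I X (f ≫ X ⊴ₗ h) g := by
  rw [pullBlock, blockMul_cls]
  have e : compM X (𝟙_ C) g (λₗ m₂).hom = (ρ_ X).hom ⊵ₗ m₂ ≫ g := by
    simp [compM]
  rw [e, ← cls_slide]
  congr 2
  simp [compN]

theorem cls_mul_pushBlock (I : Irr C) (X : C) {m₁ m₂ m₃ : M} {n₁ n₂ : N}
    (f : n₁ ⟶ X ⊙ₗ n₂) (g : X ⊙ₗ m₂ ⟶ m₁) (k : m₃ ⟶ m₂) :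
    blockMul I (cls I X f g) (pushBlock I n₂ k) = cls I X f (X ⊴ₗ k ≫ g) := by
  rw [pushBlock, blockMul_cls]
  have e : compM X (𝟙_ C) g ((λₗ m₃).hom ≫ k) = (ρ_ X).hom ⊵ₗ m₃ ≫ X ⊴ₗ k ≫ g := by
    simp [compM]
  rw [e, ← cls_slide]
  congr 2
  simp [compN]

theorem pullBlock_mul_pullBlock (I : Irr C) (m : M) {n n' n'' : N} (h : n ⟶ n')
    (h' : n' ⟶ n'') :
    blockMul I (pullBlock I m h) (pullBlock I m h') = pullBlock I m (h ≫ h') := by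
  conv_lhs => rw [pullBlock.eq_1 I m h', pullBlock_mul_cls]
  rw [pullBlock, Category.assoc]

theorem pushBlock_mul_pushBlock (I : Irr C) {m m' m'' : M} (n : N) (g : m ⟶ m')
    (g' : m' ⟶ m'') :
    blockMul I (pushBlock I n g') (pushBlock I n g) = pushBlock I n (g ≫ g') := by
  conv_lhs => rw [pushBlock.eq_1 I n g, pushBlock_mul_cls]
  rw [pushBlock, Category.assoc]

/-- Both products are the class over `𝟙_ C` of the same two morphisms. This gives the interchange
law making block modules bifunctors. -/
theorem pullBlock_mul_pushBlock (I : Irr C) {m m' : M} {n n' : N} (h : n ⟶ n') (g : m ⟶ m') :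
    blockMul I (pullBlock I m' h) (pushBlock I n' g) =
      blockMul I (pushBlock I n g) (pullBlock I m h) := by
  conv_lhs => rw [pushBlock, pullBlock_mul_cls]
  conv_rhs => rw [pullBlock, pushBlock_mul_cls]

/-- Since the elements `cls I X f g` span every block, this shows that the three kinds of generators
determine every action. -/
theorem cls_eq_mul (I : Irr C) (X : C) {m₁ m₂ : M} {n₁ n₂ : N}
    (f : n₁ ⟶ X ⊙ₗ n₂) (g : X ⊙ₗ m₂ ⟶ m₁) :
    cls I X f g = blockMul I (pushBlock I n₁ g)
      (blockMul I (pullBlock I _ f) (strBlock I X m₂ n₂)) := by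
  rw [strBlock, pullBlock_mul_cls, pushBlock_mul_cls, Category.comp_id, Category.id_comp]

theorem strBlock_mul_pullBlock (I : Irr C) (X : C) (m : M) {n n' : N} (h : n ⟶ n') :
    blockMul I (strBlock I X m n) (pullBlock I m h) =
      blockMul I (pullBlock I _ (X ⊴ₗ h)) (strBlock I X m n') := by
  rw [strBlock, strBlock, cls_mul_pullBlock, pullBlock_mul_cls, Category.comp_id,
    Category.id_comp]

theorem strBlock_mul_pushBlock (I : Irr C) (X : C) {m m' : M} (n : N) (g : m ⟶ m') :
    blockMul I (strBlock I X m' n) (pushBlock I n g) =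
      blockMul I (pushBlock I _ (X ⊴ₗ g)) (strBlock I X m n) := by
  rw [strBlock, strBlock, cls_mul_pushBlock, pushBlock_mul_cls, Category.comp_id,
    Category.id_comp]

/-- This is `cls_slide` at identity morphisms. It becomes naturality in the acting object of the lax
structure, while the next two relations become its associativity and unitality. -/
theorem pushBlock_mul_strBlock (I : Irr C) {X Y : C} (s : X ⟶ Y) (m : M) (n : N) :
    blockMul I (pushBlock I _ (s ⊵ₗ m)) (strBlock I X m n) =
      blockMul I (pullBlock I _ (s ⊵ₗ n)) (strBlock I Y m n) := by
  rw [strBlock, strBlock, pushBlock_mul_cls, pullBlock_mul_cls]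
  have := cls_slide I s (𝟙 (X ⊙ₗ n)) (𝟙 (Y ⊙ₗ m))
  simpa using this.symm

theorem strBlock_mul_strBlock (I : Irr C) (X Y : C) (m : M) (n : N) :
    blockMul I (strBlock I X (Y ⊙ₗ m) (Y ⊙ₗ n)) (strBlock I Y m n) =
      cls I (X ⊗ Y) (αₗ X Y n).inv (αₗ X Y m).hom := by
  rw [strBlock, strBlock, blockMul_cls]
  simp [compM, compN]

theorem strBlock_unit (I : Irr C) (m : M) (n : N) :
    blockMul I (pushBlock I _ (λₗ m).hom) (strBlock I (𝟙_ C) m n) = pullBlock I m (λₗ n).hom := by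
  rw [strBlock, pushBlock_mul_cls, pullBlock]
  simp

/-! ### Block modules as bifunctors with structure maps -/

variable (M N) in
/-- A family of vector spaces with compatible actions of all the blocks. -/
structure BlockModule (I : Irr C) where
  obj : M → N → Type w
  [grp : ∀ m n, AddCommGroup (obj m n)]
  [mod : ∀ m n, Module ℂ (obj m n)]
  act : ∀ {m₁ : M} {n₁ : N} {m₂ : M} {n₂ : N},
    Block I m₁ n₁ m₂ n₂ →ₗ[ℂ] obj m₂ n₂ →ₗ[ℂ] obj m₁ n₁
  act_mul : ∀ {m₁ m₂ m₃ : M} {n₁ n₂ n₃ : N} (a : Block I m₁ n₁ m₂ n₂) (b : Block I m₂ n₂ m₃ n₃)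
    (v : obj m₃ n₃), act (blockMul I a b) v = act a (act b v)
  act_one : ∀ {m : M} {n : N} (v : obj m n), act (blockOne I m n) v = v

namespace BlockModule

attribute [instance] grp mod

variable {I : Irr C} (P : BlockModule.{w} M N I)

/-- Contravariant functoriality in the second variable. -/
def pull {m : M} {n n' : N} : (n ⟶ n') →ₗ[ℂ] P.obj m n' →ₗ[ℂ] P.obj m n where
  toFun h := P.act (pullBlock I m h)
  map_add' h h' := by simp [pullBlock, Preadditive.add_comp]
  map_smul' r h := by simp [pullBlock, Linear.smul_comp]

/-- Covariant functoriality in the first variable. -/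
def push {m m' : M} {n : N} : (m ⟶ m') →ₗ[ℂ] P.obj m n →ₗ[ℂ] P.obj m' n where
  toFun g := P.act (pushBlock I n g)
  map_add' h h' := by simp [pushBlock, Preadditive.comp_add]
  map_smul' r h := by simp [pushBlock, Linear.comp_smul]

/-- The action of the tautological element. -/
def str (X : C) {m : M} {n : N} : P.obj m n →ₗ[ℂ] P.obj (X ⊙ₗ m) (X ⊙ₗ n) :=
  P.act (strBlock I X m n)

theorem pull_apply {m : M} {n n' : N} (h : n ⟶ n') (v : P.obj m n') :
    P.pull h v = P.act (pullBlock I m h) v := rfl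

theorem push_apply {m m' : M} {n : N} (g : m ⟶ m') (v : P.obj m n) :
    P.push g v = P.act (pushBlock I n g) v := rfl

theorem pull_id {m : M} {n : N} (v : P.obj m n) : P.pull (𝟙 n) v = v := by
  have : pullBlock I m (𝟙 n) = blockOne I m n := by simp [pullBlock, blockOne]
  simp [pull_apply, this, act_one]

theorem push_id {m : M} {n : N} (v : P.obj m n) : P.push (𝟙 m) v = v := by
  have : pushBlock I n (𝟙 m) = blockOne I m n := by simp [pushBlock, blockOne]
  simp [push_apply, this, act_one]

theorem pull_comp {m : M} {n n' n'' : N} (h : n ⟶ n') (h' : n' ⟶ n'') (v : P.obj m n'') :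
    P.pull (h ≫ h') v = P.pull h (P.pull h' v) := by
  simp [pull_apply, ← act_mul, pullBlock_mul_pullBlock]

theorem push_comp {m m' m'' : M} {n : N} (g : m ⟶ m') (g' : m' ⟶ m'') (v : P.obj m n) :
    P.push (g ≫ g') v = P.push g' (P.push g v) := by
  simp [push_apply, ← act_mul, pushBlock_mul_pushBlock]

theorem pull_push {m m' : M} {n n' : N} (h : n ⟶ n') (g : m ⟶ m') (v : P.obj m n') :
    P.pull h (P.push g v) = P.push g (P.pull h v) := by
  simp [pull_apply, push_apply, ← act_mul, pullBlock_mul_pushBlock]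

theorem act_cls (X : C) {m₁ m₂ : M} {n₁ n₂ : N} (f : n₁ ⟶ X ⊙ₗ n₂) (g : X ⊙ₗ m₂ ⟶ m₁)
    (v : P.obj m₂ n₂) : P.act (cls I X f g) v = P.push g (P.pull f (P.str X v)) := by
  simp [pull_apply, push_apply, str, ← act_mul, ← cls_eq_mul]

theorem str_pull (X : C) {m : M} {n n' : N} (h : n ⟶ n') (v : P.obj m n') :
    P.str X (P.pull h v) = P.pull (X ⊴ₗ h) (P.str X v) := by
  simp [pull_apply, str, ← act_mul, strBlock_mul_pullBlock]

theorem str_push (X : C) {m m' : M} {n : N} (g : m ⟶ m') (v : P.obj m n) :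
    P.str X (P.push g v) = P.push (X ⊴ₗ g) (P.str X v) := by
  simp [push_apply, str, ← act_mul, strBlock_mul_pushBlock]

theorem push_str {X Y : C} (s : X ⟶ Y) {m : M} {n : N} (v : P.obj m n) :
    P.push (s ⊵ₗ m) (P.str X v) = P.pull (s ⊵ₗ n) (P.str Y v) := by
  simp [push_apply, pull_apply, str, ← act_mul, pushBlock_mul_strBlock]

theorem str_str (X Y : C) {m : M} {n : N} (v : P.obj m n) :
    P.str X (P.str Y v) =
      P.push (αₗ X Y m).hom (P.pull (αₗ X Y n).inv (P.str (X ⊗ Y) v)) := by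
  rw [← act_cls, ← strBlock_mul_strBlock, act_mul]
  rfl

theorem push_str_unit {m : M} {n : N} (v : P.obj m n) :
    P.push (λₗ m).hom (P.str (𝟙_ C) v) = P.pull (λₗ n).hom v := by
  simp [push_apply, pull_apply, str, ← act_mul, strBlock_unit]

end BlockModule

end BlockModules

/-! ### Schur's lemma and testing morphisms on simple objects -/

section Irr

variable {C : Type u₁} [Category.{v₁} C] [Abelian C] [Linear ℂ C] [FiniteSemisimple C]

theorem Irr.hom_eq_zero (I : Irr C) {a b : Fin I.card} (h : a ≠ b) (s : I.obj a ⟶ I.obj b) :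
    s = 0 := by
  have := I.simple a
  have := I.simple b
  by_contra hs
  have := isIso_of_hom_simple hs
  exact h (I.eq_of_iso a b ⟨asIso s⟩)

theorem Irr.exists_eq_smul_id (I : Irr C) {a : Fin I.card} (s : I.obj a ⟶ I.obj a) :
    ∃ c : ℂ, c • 𝟙 (I.obj a) = s := by
  have := I.simple a
  have := FiniteSemisimple.finite_hom (I.obj a) (I.obj a)
  exact endomorphism_simple_eq_smul_id ℂ s

/-- Morphisms which agree after precomposition with all morphisms from simple objects agree. -/
theorem Irr.hom_ext (I : Irr C) {X Y : C} {f g : X ⟶ Y}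
    (h : ∀ (a : Fin I.card) (s : I.obj a ⟶ X), s ≫ f = s ≫ g) : f = g := by
  have D := decomposition I X
  rw [← Category.id_comp f, ← Category.id_comp g, ← D.sum_π_ι, Preadditive.sum_comp,
    Preadditive.sum_comp]
  exact Finset.sum_congr rfl fun j _ => by rw [Category.assoc, Category.assoc, h]

end Irr

section BlockModules

variable {C : Type u₁} [Category.{v₁} C] [Abelian C] [Linear ℂ C] [FiniteSemisimple C]
  [MonoidalCategory C] [MonoidalPreadditive C] [MonoidalLinear ℂ C]
variable {M : Type u₂} [Category.{v₂} M] [Abelian M] [Linear ℂ M]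
  [MonoidalLeftAction C M] [LinearAction C M]
variable {N : Type u₃} [Category.{v₃} N] [Abelian N] [Linear ℂ N]
  [MonoidalLeftAction C N] [LinearAction C N]

namespace BlockModule

/-! ### Representability over a semisimple category -/

section Representing

variable {I : Irr C} (P : BlockModule.{w} M N I) [FiniteSemisimple N]

/-- An element `u` represents the presheaf `P.obj m` if every element is uniquely a pullback
of `u`. -/
def IsUniversal {m : M} {X : N} (u : P.obj m X) : Prop :=
  ∀ n : N, Function.Bijective fun h : n ⟶ X => P.pull h u

/-- Linear presheaves turn finite direct sums into products: decompose `n`, classify the restriction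
to each summand, and reassemble. -/
theorem isUniversal_of_irr (K : Irr N) {m : M} {X : N} (u : P.obj m X)
    (h : ∀ k, Function.Bijective fun h : K.obj k ⟶ X => P.pull h u) : P.IsUniversal u := by
  intro n
  have D := decomposition K n
  constructor
  · intro f g hfg
    refine K.hom_ext fun k s => (h k).1 ?_
    simp only [pull_comp]
    exact congrArg _ hfg
  · intro v
    choose g hg using fun j => (h (D.label j)).2 (P.pull (D.ι j) v)
    refine ⟨∑ j, D.π j ≫ g j, ?_⟩
    have : ∀ j, P.pull (D.π j ≫ g j) u = P.pull (D.π j ≫ D.ι j) v := fun j => by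
      rw [pull_comp, pull_comp, ← hg j]
    simp only [map_sum, LinearMap.sum_apply, this]
    rw [← LinearMap.sum_apply, ← map_sum, D.sum_π_ι, pull_id]

/-- The representing object is the sum of the simple objects `K.obj k`, each with multiplicity `dim
P(m, K.obj k)`. Universality need only be tested on simple objects. -/
theorem exists_isUniversal (K : Irr N) (m : M) [∀ n, FiniteDimensional ℂ (P.obj m n)] :
    ∃ (X : N) (u : P.obj m X), P.IsUniversal u := by
  classical
  let b := fun k => Module.finBasis ℂ (P.obj m (K.obj k))
  let σ := Σ k : Fin K.card, Fin (Module.finrank ℂ (P.obj m (K.obj k)))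
  let S : σ → N := fun s => K.obj s.1
  -- The universal element has as its component at each summand the basis vector indexing that
  -- summand.
  let u : P.obj m (⨁ S) := ∑ s, P.pull (biproduct.π S s) (b s.1 s.2)
  have hu : ∀ {n : N} (h : n ⟶ ⨁ S),
      P.pull h u = ∑ s, P.pull (h ≫ biproduct.π S s) (b s.1 s.2) := fun h => by
    simp only [u, map_sum, pull_comp]
  refine ⟨⨁ S, u, P.isUniversal_of_irr K u fun k => ⟨?_, ?_⟩⟩
  · intro f g hfg
    rw [← sub_eq_zero]
    have h0 : P.pull (f - g) u = 0 := by
      rw [map_sub, LinearMap.sub_apply, sub_eq_zero]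
      exact hfg
    generalize f - g = h at h0
    -- By Schur, `h` has scalar components at the copies of `K.obj k` and zero components elsewhere,
    -- so `P.pull h u` is the combination of basis vectors with these scalars as coefficients.
    choose c hc using fun j => K.exists_eq_smul_id (h ≫ biproduct.π S ⟨k, j⟩)
    rw [hu, Fintype.sum_sigma, Finset.sum_eq_single k] at h0
    · simp only [← hc, map_smul, LinearMap.smul_apply, pull_id] at h0
      have hc0 := Fintype.linearIndependent_iff.1 (b k).linearIndependent c h0
      refine biproduct.hom_ext _ _ fun s => ?_
      obtain ⟨l, j⟩ := s
      rw [zero_comp]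
      by_cases hl : k = l
      · subst hl
        rw [← hc, hc0, zero_smul]
      · exact K.hom_eq_zero hl _
    · intro l _ hl
      refine Finset.sum_eq_zero fun j _ => ?_
      rw [K.hom_eq_zero hl.symm (h ≫ biproduct.π S ⟨l, j⟩), map_zero, LinearMap.zero_apply]
    · simp
  · intro v
    have hι : ∀ j, P.pull (biproduct.ι S ⟨k, j⟩) u = b k j := fun j => by
      rw [hu, Finset.sum_eq_single ⟨k, j⟩]
      · rw [biproduct.ι_π_self, pull_id]
      · intro t _ ht
        rw [biproduct.ι_π_ne S ht.symm, map_zero, LinearMap.zero_apply]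
      · simp
    refine ⟨∑ j, (b k).repr v j • biproduct.ι S ⟨k, j⟩, ?_⟩
    simp only [map_sum, map_smul, LinearMap.sum_apply, LinearMap.smul_apply, hι]
    exact (b k).sum_repr v

end Representing

/-! ### The lax module functor represented by a block module -/

section ToFunctor

variable {I : Irr C} {P : BlockModule.{w} M N I} {R : M → N} {u : ∀ m, P.obj m (R m)}
  (hu : ∀ m, P.IsUniversal (u m))

/-- The morphism to the representing object classifying an element. -/
def IsUniversal.lift {m : M} {X : N} {u : P.obj m X} (hu : P.IsUniversal u) {n : N}
    (v : P.obj m n) : n ⟶ X :=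
  ((hu n).2 v).choose

theorem IsUniversal.pull_lift {m : M} {X : N} {u : P.obj m X} (hu : P.IsUniversal u) {n : N}
    (v : P.obj m n) : P.pull (hu.lift v) u = v :=
  ((hu n).2 v).choose_spec

theorem IsUniversal.hom_ext {m : M} {X : N} {u : P.obj m X} (hu : P.IsUniversal u) {n : N}
    {f g : n ⟶ X} (h : P.pull f u = P.pull g u) : f = g :=
  (hu n).1 h

/-- The functor represented by a block module. -/
def functor : M ⥤ N where
  obj := R
  map {m m'} g := (hu m').lift (P.push g (u m))
  map_id m := (hu m).hom_ext (by rw [(hu m).pull_lift, push_id, pull_id])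
  map_comp {m m' m''} g g' := (hu m'').hom_ext (by
    rw [(hu m'').pull_lift, pull_comp, (hu m'').pull_lift, pull_push, (hu m').pull_lift,
      push_comp])

/-- The universal element, as an element over the value of the functor. -/
def univ (m : M) : P.obj m ((functor hu).obj m) := u m

theorem isUniversal_univ (m : M) : P.IsUniversal (univ hu m) := hu m

theorem pull_functor_map {m m' : M} (g : m ⟶ m') :
    P.pull ((functor hu).map g) (univ hu m') = P.push g (univ hu m) :=
  (hu m').pull_lift _

instance : (functor hu).Additive where
  map_add {m m'} f g := (isUniversal_univ hu m').hom_ext (by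
    simp only [pull_functor_map, map_add, LinearMap.add_apply])

instance : (functor hu).Linear ℂ where
  map_smul {m m'} f r := (isUniversal_univ hu m').hom_ext (by
    simp only [pull_functor_map, map_smul, LinearMap.smul_apply])

/-- The structure morphism of the functor represented by a block module. -/
def functorμ (c : C) (m : M) : c ⊙ₗ (functor hu).obj m ⟶ (functor hu).obj (c ⊙ₗ m) :=
  (isUniversal_univ hu (c ⊙ₗ m)).lift (P.str c (univ hu m))

theorem pull_functorμ (c : C) (m : M) :
    P.pull (functorμ hu c m) (univ hu (c ⊙ₗ m)) = P.str c (univ hu m) :=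
  (isUniversal_univ hu (c ⊙ₗ m)).pull_lift _

/-- Morphisms into a representing object are detected by pulling back the universal element, so each
coherence axiom reduces to the matching relation between `str`, `pull` and `push`. -/
instance : (functor hu).LaxLeftLinear C where
  μₗ := functorμ hu
  μₗ_naturality_left {c c'} f m := (isUniversal_univ hu _).hom_ext (by
    rw [pull_comp, pull_comp, pull_functorμ, pull_functor_map, pull_push, pull_functorμ, push_str])
  μₗ_naturality_right c {m m'} f := (isUniversal_univ hu _).hom_ext (by
    rw [pull_comp, pull_comp, pull_functorμ, pull_functor_map, pull_push, pull_functorμ,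
      ← str_pull, pull_functor_map, str_push])
  μₗ_associativity c c' m := (isUniversal_univ hu _).hom_ext (by
    rw [pull_comp, pull_comp, pull_comp, pull_functorμ, pull_functor_map, pull_push,
      pull_functorμ, ← str_pull, pull_functorμ, str_str, pull_push, ← pull_comp, Iso.hom_inv_id,
      pull_id])
  μₗ_unitality m := (isUniversal_univ hu _).hom_ext (by
    rw [pull_comp, pull_functor_map, pull_push, pull_functorμ, push_str_unit])

/-- The lax module functor represented by a block module. -/
abbrev laxModuleFunctor : LaxModuleFunctor C M N where
  toFunctor := functor hu

end ToFunctor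

end BlockModule

/-! ### The block module of a lax module functor -/

section OfFunctor

variable (F : LaxModuleFunctor C M N)

/-- The action of `f : n₁ ⟶ X ⊙ n₂` and `g : X ⊙ m₂ ⟶ m₁` on `v : n₂ ⟶ F(m₂)`. -/
def actHom (X : C) (m₁ m₂ : M) (n₁ n₂ : N) :
    (n₁ ⟶ X ⊙ₗ n₂) →ₗ[ℂ] (X ⊙ₗ m₂ ⟶ m₁) →ₗ[ℂ]
      (n₂ ⟶ F.toFunctor.obj m₂) →ₗ[ℂ] (n₁ ⟶ F.toFunctor.obj m₁) :=
  LinearMap.mk₂ ℂ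
    (fun f g =>
      { toFun v := f ≫ X ⊴ₗ v ≫ F.μ X m₂ ≫ F.toFunctor.map g
        map_add' v v' := by
          simp [LinearAction.right_add, Preadditive.comp_add, Preadditive.add_comp]
        map_smul' r v := by simp [LinearAction.right_smul, Linear.smul_comp, Linear.comp_smul] })
    (fun f f' g => by ext v; simp [Preadditive.add_comp])
    (fun r f g => by ext v; simp)
    (fun f g g' => by ext v; simp [Functor.map_add, Preadditive.comp_add])
    (fun r f g => by ext v; simp [Functor.map_smul])

theorem actHom_apply (X : C) {m₁ m₂ : M} {n₁ n₂ : N} (f : n₁ ⟶ X ⊙ₗ n₂) (g : X ⊙ₗ m₂ ⟶ m₁)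
    (v : n₂ ⟶ F.toFunctor.obj m₂) :
    actHom F X m₁ m₂ n₁ n₂ f g v = f ≫ X ⊴ₗ v ≫ F.μ X m₂ ≫ F.toFunctor.map g := rfl

/-- The action of a block on morphisms to the values of `F`. -/
def actBlock (I : Irr C) (m₁ m₂ : M) (n₁ n₂ : N) :
    Block I m₁ n₁ m₂ n₂ →ₗ[ℂ] (n₂ ⟶ F.toFunctor.obj m₂) →ₗ[ℂ] (n₁ ⟶ F.toFunctor.obj m₁) :=
  ∑ x, TensorProduct.lift (actHom F (I.obj x) m₁ m₂ n₁ n₂) ∘ₗ LinearMap.proj x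

theorem actBlock_single (I : Irr C) {m₁ m₂ : M} {n₁ n₂ : N} (x : Fin I.card)
    (f : n₁ ⟶ I.obj x ⊙ₗ n₂) (g : I.obj x ⊙ₗ m₂ ⟶ m₁) (v : n₂ ⟶ F.toFunctor.obj m₂) :
    actBlock F I m₁ m₂ n₁ n₂ (Pi.single x (f ⊗ₜ[ℂ] g)) v =
      f ≫ I.obj x ⊴ₗ v ≫ F.μ (I.obj x) m₂ ≫ F.toFunctor.map g := by
  simp only [actBlock, LinearMap.sum_apply, LinearMap.comp_apply, LinearMap.proj_apply]
  rw [Finset.sum_eq_single x]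
  · simp [actHom_apply]
  · intro b _ hb; simp [Pi.single_eq_of_ne hb]
  · simp

/-- Exchange moves each projection of the decomposition past `v`, and naturality of the structure
morphism moves it inside `F`, where it meets its inclusion; the composites sum to the identity of
`X`. -/
theorem actBlock_cls (I : Irr C) (X : C) {m₁ m₂ : M} {n₁ n₂ : N}
    (f : n₁ ⟶ X ⊙ₗ n₂) (g : X ⊙ₗ m₂ ⟶ m₁) (v : n₂ ⟶ F.toFunctor.obj m₂) :
    actBlock F I m₁ m₂ n₁ n₂ (cls I X f g) v =
      f ≫ X ⊴ₗ v ≫ F.μ X m₂ ≫ F.toFunctor.map g := by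
  rw [cls_apply]
  generalize decomposition I X = D
  simp only [map_sum, LinearMap.sum_apply, actBlock_single]
  have h : ∀ j, (f ≫ D.π j ⊵ₗ n₂) ≫ I.obj (D.label j) ⊴ₗ v ≫ F.μ (I.obj (D.label j)) m₂ ≫
      F.toFunctor.map (D.ι j ⊵ₗ m₂ ≫ g) =
      f ≫ X ⊴ₗ v ≫ F.μ X m₂ ≫ F.toFunctor.map ((D.π j ≫ D.ι j) ⊵ₗ m₂ ≫ g) := fun j => by
    rw [Category.assoc, ← action_exchange_assoc, Functor.LaxLeftLinear.μₗ_naturality_left_assoc,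
      ← F.toFunctor.map_comp, comp_actionHomLeft, Category.assoc]
  simp only [h, ← Preadditive.comp_sum, ← Functor.map_sum, ← Preadditive.sum_comp, ← sum_action,
    D.sum_π_ι, id_actionHomLeft, Category.id_comp]

/-- The block module of morphisms to the values of a lax module functor. -/
def LaxModuleFunctor.blockModule (I : Irr C) : BlockModule.{v₃} M N I where
  obj m n := n ⟶ F.toFunctor.obj m
  act := actBlock F I _ _ _ _
  act_mul a b v := by
    induction a using block_induction with
    | h0 => simp
    | hadd a a' h h' => simp [h, h']
    | hcls X f g =>
    induction b using block_induction with
    | h0 => simp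
    | hadd a a' h h' => simp [h, h']
    | hcls Y f' g' =>
    simp [blockMul_cls, actBlock_cls, compN, compM]
  act_one v := by
    simp [blockOne, actBlock_cls]

end OfFunctor

end BlockModules

/-! ### Restriction to simple pairs as a module over the algebra -/

section Restriction

variable {C : Type u₁} [Category.{v₁} C] [Abelian C] [Linear ℂ C] [FiniteSemisimple C]
  [MonoidalCategory C] [MonoidalPreadditive C] [MonoidalLinear ℂ C]
variable {M : Type u₂} [Category.{v₂} M] [Abelian M] [Linear ℂ M]
  [MonoidalLeftAction C M] [LinearAction C M]
variable {N : Type u₃} [Category.{v₃} N] [Abelian N] [Linear ℂ N]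
  [MonoidalLeftAction C N] [LinearAction C N]
variable {I : Irr C}

namespace BlockModule

variable (P : BlockModule.{w} M N I) (J : Irr M) (K : Irr N)

/-- The total space of a block module over the pairs of simple objects. -/
def Restriction : Type w := ∀ q : Fin J.card × Fin K.card, P.obj (J.obj q.1) (K.obj q.2)

instance : AddCommGroup (P.Restriction J K) :=
  inferInstanceAs (AddCommGroup (∀ q : Fin J.card × Fin K.card, P.obj (J.obj q.1) (K.obj q.2)))

instance : Module ℂ (P.Restriction J K) :=
  inferInstanceAs (Module ℂ (∀ q : Fin J.card × Fin K.card, P.obj (J.obj q.1) (K.obj q.2)))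

instance [∀ m n, FiniteDimensional ℂ (P.obj m n)] : FiniteDimensional ℂ (P.Restriction J K) :=
  inferInstanceAs
    (FiniteDimensional ℂ (∀ q : Fin J.card × Fin K.card, P.obj (J.obj q.1) (K.obj q.2)))

namespace Restriction

variable {P J K}

@[ext]
theorem ext {v v' : P.Restriction J K} (h : ∀ q, v q = v' q) : v = v' := funext h

theorem add_apply (v v' : P.Restriction J K) (q : Fin J.card × Fin K.card) :
    (v + v') q = v q + v' q := rfl

theorem zero_apply (q : Fin J.card × Fin K.card) : (0 : P.Restriction J K) q = 0 := rfl

theorem smul_apply (c : ℂ) (v : P.Restriction J K) (q : Fin J.card × Fin K.card) :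
    (c • v) q = c • v q := rfl

theorem sum_apply {σ : Type*} (s : Finset σ) (v : σ → P.Restriction J K)
    (q : Fin J.card × Fin K.card) : (∑ i ∈ s, v i) q = ∑ i ∈ s, v i q :=
  Finset.sum_apply q s v

instance : SMul (KKAlgebra I J K) (P.Restriction J K) where
  smul a v := fun p => ∑ q, P.act (a p q) (v q)

theorem algebra_smul_apply (a : KKAlgebra I J K) (v : P.Restriction J K)
    (p : Fin J.card × Fin K.card) : (a • v) p = ∑ q, P.act (a p q) (v q) := rfl

instance : Module (KKAlgebra I J K) (P.Restriction J K) where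
  one_smul v := by
    ext p
    rw [algebra_smul_apply, Finset.sum_eq_single p, KKAlgebra.one_apply_self, act_one]
    · intro q _ h
      rw [KKAlgebra.one_apply_ne h.symm, map_zero, LinearMap.zero_apply]
    · simp
  mul_smul a b v := by
    ext p
    simp only [algebra_smul_apply, KKAlgebra.mul_apply, map_sum, LinearMap.sum_apply, act_mul]
    exact Finset.sum_comm
  smul_zero a := by
    ext p
    simp only [algebra_smul_apply, zero_apply, map_zero, Finset.sum_const_zero]
  smul_add a v w := by
    ext p
    simp only [algebra_smul_apply, add_apply, map_add, Finset.sum_add_distrib]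
  add_smul a b v := by
    ext p
    simp only [algebra_smul_apply, add_apply, KKAlgebra.add_apply, map_add, LinearMap.add_apply,
      Finset.sum_add_distrib]
  zero_smul v := by
    ext p
    simp only [algebra_smul_apply, zero_apply, KKAlgebra.zero_apply, map_zero,
      LinearMap.zero_apply, Finset.sum_const_zero]

instance : IsScalarTower ℂ (KKAlgebra I J K) (P.Restriction J K) where
  smul_assoc c a v := by
    ext p
    simp only [algebra_smul_apply, smul_apply, KKAlgebra.smul_apply, map_smul,
      LinearMap.smul_apply, Finset.smul_sum]

/-- The element concentrated in one component. -/
def single (q : Fin J.card × Fin K.card) (x : P.obj (J.obj q.1) (K.obj q.2)) :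
    P.Restriction J K :=
  Pi.single q x

theorem single_apply_self (q : Fin J.card × Fin K.card) (x : P.obj (J.obj q.1) (K.obj q.2)) :
    single q x q = x :=
  Pi.single_eq_same
    (M := fun q : Fin J.card × Fin K.card => P.obj (J.obj q.1) (K.obj q.2)) q x

theorem single_apply_ne {p q : Fin J.card × Fin K.card} (h : p ≠ q)
    (x : P.obj (J.obj q.1) (K.obj q.2)) : single q x p = 0 :=
  Pi.single_eq_of_ne
    (M := fun q : Fin J.card × Fin K.card => P.obj (J.obj q.1) (K.obj q.2)) h x

end Restriction

end BlockModule

/-- The matrix with a single nonzero entry. -/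
def KKAlgebra.single {J : Irr M} {K : Irr N} (p q : Fin J.card × Fin K.card)
    (b : Block I (J.obj p.1) (K.obj p.2) (J.obj q.1) (K.obj q.2)) : KKAlgebra I J K :=
  Pi.single p (Pi.single q b)

theorem KKAlgebra.single_smul {J : Irr M} {K : Irr N} (p q : Fin J.card × Fin K.card)
    (b : Block I (J.obj p.1) (K.obj p.2) (J.obj q.1) (K.obj q.2)) {P : BlockModule.{w} M N I}
    (v : P.Restriction J K) :
    KKAlgebra.single p q b • v = BlockModule.Restriction.single p (P.act b (v q)) := by
  ext s
  rw [BlockModule.Restriction.algebra_smul_apply, Finset.sum_eq_single q]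
  · by_cases h : s = p
    · subst h
      simp [KKAlgebra.single, BlockModule.Restriction.single_apply_self]
    · rw [BlockModule.Restriction.single_apply_ne h, KKAlgebra.single, Pi.single_eq_of_ne h]
      simp
  · intro r _ hr
    by_cases h : s = p
    · subst h
      simp [KKAlgebra.single, Pi.single_eq_of_ne hr]
    · rw [KKAlgebra.single, Pi.single_eq_of_ne h]
      simp
  · simp

namespace BlockModule

/-! ### Extending linear maps from simple pairs to all pairs -/

section Extension

universe w'

variable {P : BlockModule.{w} M N I} {P' : BlockModule.{w'} M N I} {J : Irr M} {K : Irr N}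

/-- The linear map on restrictions induced by a family of maps commuting with the blocks. -/
def restrictionMap (T : ∀ m n, P.obj m n →ₗ[ℂ] P'.obj m n)
    (hT : ∀ {m₁ m₂ : M} {n₁ n₂ : N} (b : Block I m₁ n₁ m₂ n₂) (v : P.obj m₂ n₂),
      T m₁ n₁ (P.act b v) = P'.act b (T m₂ n₂ v)) :
    P.Restriction J K →ₗ[KKAlgebra I J K] P'.Restriction J K where
  toFun v := fun q => T _ _ (v q)
  map_add' v w := by
    ext q
    exact map_add (T _ _) (v q) (w q)
  map_smul' a v := by
    ext q
    change T _ _ ((a • v) q) = _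
    rw [Restriction.algebra_smul_apply, map_sum]
    exact Finset.sum_congr rfl fun _ _ => hT _ _

theorem pullBlock_sum (m : M) {n n' : N} {σ : Type*} (s : Finset σ) (h : σ → (n ⟶ n')) :
    ∑ i ∈ s, pullBlock I m (h i) = pullBlock I m (∑ i ∈ s, h i) := by
  simp [pullBlock, Preadditive.sum_comp]

theorem pushBlock_sum {m m' : M} (n : N) {σ : Type*} (s : Finset σ) (g : σ → (m ⟶ m')) :
    ∑ i ∈ s, pushBlock I n (g i) = pushBlock I n (∑ i ∈ s, g i) := by
  simp [pushBlock, Preadditive.comp_sum]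

variable (I J K) in
/-- The identity of every pair of objects factors through pairs of simple objects. -/
theorem exists_sum_eq_blockOne [FiniteSemisimple M] [FiniteSemisimple N] (m : M) (n : N) :
    ∃ (d : ℕ) (q : Fin d → Fin J.card × Fin K.card)
      (a : ∀ s, Block I m n (J.obj (q s).1) (K.obj (q s).2))
      (b : ∀ s, Block I (J.obj (q s).1) (K.obj (q s).2) m n),
      ∑ s, blockMul I (a s) (b s) = blockOne I m n := by
  have D := decomposition J m
  have E := decomposition K n
  let e := (Fintype.equivFin (Fin D.card × Fin E.card)).symm
  refine ⟨_, fun s => (D.label (e s).1, E.label (e s).2),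
    fun s => blockMul I (pullBlock I m (E.π (e s).2)) (pushBlock I _ (D.ι (e s).1)),
    fun s => blockMul I (pushBlock I _ (D.π (e s).1)) (pullBlock I m (E.ι (e s).2)), ?_⟩
  rw [e.sum_comp fun s => blockMul I (blockMul I (pullBlock I m (E.π s.2))
    (pushBlock I _ (D.ι s.1))) (blockMul I (pushBlock I _ (D.π s.1)) (pullBlock I m (E.ι s.2)))]
  -- Interchange collects the morphisms of `M` and those of `N`, so the double sum splits into the
  -- two resolutions of the identity.
  have h : ∀ j l, blockMul I (blockMul I (pullBlock I m (E.π l)) (pushBlock I _ (D.ι j)))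
      (blockMul I (pushBlock I _ (D.π j)) (pullBlock I m (E.ι l))) =
      blockMul I (pushBlock I n (D.π j ≫ D.ι j)) (pullBlock I m (E.π l ≫ E.ι l)) := fun j l => by
    rw [pullBlock_mul_pushBlock, blockMul_assoc, ← blockMul_assoc I (pullBlock I _ (E.π l)),
      pullBlock_mul_pushBlock, blockMul_assoc, pullBlock_mul_pullBlock, ← blockMul_assoc,
      pushBlock_mul_pushBlock]
  have hM : pushBlock I n (𝟙 m) = blockOne I m n := by simp [pushBlock, blockOne]
  have hN : pullBlock I m (𝟙 n) = blockOne I m n := by simp [pullBlock, blockOne]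
  simp only [h, Fintype.sum_prod_type, ← map_sum, ← LinearMap.sum_apply, pullBlock_sum,
    pushBlock_sum, D.sum_π_ι, E.sum_π_ι, hM, hN, blockOne_mul]

theorem sum_act_act (P : BlockModule.{w} M N I) {m : M} {n : N} {d : ℕ}
    {q : Fin d → Fin J.card × Fin K.card}
    {a : ∀ s, Block I m n (J.obj (q s).1) (K.obj (q s).2)}
    {b : ∀ s, Block I (J.obj (q s).1) (K.obj (q s).2) m n}
    (h : ∑ s, blockMul I (a s) (b s) = blockOne I m n) (v : P.obj m n) :
    ∑ s, P.act (a s) (P.act (b s) v) = v := by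
  simp only [← act_mul, ← LinearMap.sum_apply, ← map_sum, h, act_one]

/-- Linear maps between restrictions extend to all objects. -/
theorem exists_extension [FiniteSemisimple M] [FiniteSemisimple N]
    (t : P.Restriction J K →ₗ[KKAlgebra I J K] P'.Restriction J K) :
    ∃ T : ∀ m n, P.obj m n → P'.obj m n,
      (∀ {m₁ m₂ : M} {n₁ n₂ : N} (b : Block I m₁ n₁ m₂ n₂) (v : P.obj m₂ n₂),
        T m₁ n₁ (P.act b v) = P'.act b (T m₂ n₂ v)) ∧
      ∀ v q, t v q = T _ _ (v q) := by
  -- Commuting with the diagonal idempotents forces `t` to act componentwise; `t'` are its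
  -- components.
  let t' : ∀ q : Fin J.card × Fin K.card, P.obj (J.obj q.1) (K.obj q.2) →
      P'.obj (J.obj q.1) (K.obj q.2) := fun q x => t (Restriction.single q x) q
  have ht' : ∀ v q, t v q = t' q (v q) := fun v q => by
    have := congrArg (fun w => w q) (map_smul t (KKAlgebra.single q q (blockOne I _ _)) v)
    simp only [KKAlgebra.single_smul, act_one, Restriction.single_apply_self] at this
    exact this.symm
  have hact : ∀ p q (b : Block I (J.obj p.1) (K.obj p.2) (J.obj q.1) (K.obj q.2)) x,
      t' p (P.act b x) = P'.act b (t' q x) := fun p q b x => by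
    have := congrArg (fun w => w p) (map_smul t (KKAlgebra.single p q b) (Restriction.single q x))
    simpa only [KKAlgebra.single_smul, Restriction.single_apply_self] using this
  have hsum : ∀ q (d : ℕ) (x : Fin d → P.obj (J.obj q.1) (K.obj q.2)),
      t' q (∑ s, x s) = ∑ s, t' q (x s) := fun q d x => by
    have hs : Restriction.single (P := P) q (∑ s, x s) = ∑ s, Restriction.single q (x s) :=
      map_sum (LinearMap.single ℂ
        (fun q : Fin J.card × Fin K.card => P.obj (J.obj q.1) (K.obj q.2)) q) x _
    simp only [t', hs, map_sum, Restriction.sum_apply]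
  choose d q a b hab using exists_sum_eq_blockOne I J K
  -- Write `v = ∑ aₛ bₛ v` with `bₛ v` over a simple pair; equivariance then dictates the value `∑
  -- aₛ t'(bₛ v)`.
  refine ⟨fun m n v => ∑ s, P'.act (a m n s) (t' _ (P.act (b m n s) v)), ?_, ?_⟩
  · intro m₁ m₂ n₁ n₂ c v
    have h : ∀ s, t' _ (P.act (b m₁ n₁ s) (P.act c v)) = P'.act (b m₁ n₁ s) (P'.act c
        (∑ s', P'.act (a m₂ n₂ s') (t' _ (P.act (b m₂ n₂ s') v)))) := fun s => by
      -- After inserting the factored identity, `b c a` is a block between simple pairs, where `t'`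
      -- is already equivariant.
      conv_lhs => rw [← P.sum_act_act (hab m₂ n₂) v]
      simp only [map_sum, hsum, ← act_mul]
      refine Finset.sum_congr rfl fun s' _ => ?_
      rw [← blockMul_assoc, ← blockMul_assoc, act_mul, hact]
      simp only [act_mul]
    simp only [h]
    exact P'.sum_act_act (hab m₁ n₁) _
  · intro v q'
    rw [ht']
    conv_lhs => rw [← P.sum_act_act (hab _ _) (v q'), hsum]
    simp only [hact]

end Extension

end BlockModule

end Restriction

/-! ### Regular and coinduced block modules -/

section Regular

variable {C : Type u₁} [Category.{v₁} C] [Abelian C] [Linear ℂ C] [FiniteSemisimple C]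
  [MonoidalCategory C] [MonoidalPreadditive C] [MonoidalLinear ℂ C]
variable {M : Type u₂} [Category.{v₂} M] [Abelian M] [Linear ℂ M]
  [MonoidalLeftAction C M] [LinearAction C M]
variable {N : Type u₃} [Category.{v₃} N] [Abelian N] [Linear ℂ N]
  [MonoidalLeftAction C N] [LinearAction C N]

theorem KKAlgebra.sum_apply {I : Irr C} {J : Irr M} {K : Irr N} {σ : Type*} (s : Finset σ)
    (a : σ → KKAlgebra I J K) (p q : Fin J.card × Fin K.card) :
    (∑ i ∈ s, a i) p q = ∑ i ∈ s, a i p q := by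
  classical
  induction s using Finset.induction_on with
  | empty => rfl
  | insert i s h ih => rw [Finset.sum_insert h, Finset.sum_insert h, KKAlgebra.add_apply, ih]

namespace BlockModule

/-- The block module of the blocks with a fixed column. -/
def regular (I : Irr C) (m : M) (n : N) : BlockModule.{max v₂ v₃} M N I where
  obj m' n' := Block I m' n' m n
  act := blockMul I
  act_mul := blockMul_assoc I
  act_one := blockOne_mul I

instance (I : Irr C) (m : M) (n : N) [FiniteSemisimple M] [FiniteSemisimple N] (m' : M) (n' : N) :
    FiniteDimensional ℂ ((regular I m n).obj m' n') := by
  have := fun x : Fin I.card => FiniteSemisimple.finite_hom n' (I.obj x ⊙ₗ n)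
  have := fun x : Fin I.card => FiniteSemisimple.finite_hom (I.obj x ⊙ₗ m) m'
  exact inferInstanceAs (FiniteDimensional ℂ (Block I m' n' m n))

variable {I : Irr C} (J : Irr M) (K : Irr N)

/-- Right multiplication by an element of a block. -/
def rightMul {m₁ m₂ : M} {n₁ n₂ : N} :
    Block I m₁ n₁ m₂ n₂ →ₗ[ℂ]
      (regular I m₁ n₁).Restriction J K →ₗ[KKAlgebra I J K] (regular I m₂ n₂).Restriction J K where
  toFun b := restrictionMap (fun _ _ => (blockMul I).flip b)
    (fun a c => blockMul_assoc I a c b)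
  map_add' b b' := by
    ext r q
    exact map_add (blockMul I (r q)) b b'
  map_smul' c b := by
    ext r q
    exact map_smul (blockMul I (r q)) c b

theorem rightMul_apply {m₁ m₂ : M} {n₁ n₂ : N} (b : Block I m₁ n₁ m₂ n₂)
    (r : (regular I m₁ n₁).Restriction J K) (q : Fin J.card × Fin K.card) :
    rightMul J K b r q = blockMul I (r q) b := rfl

variable (W : Type w) [AddCommGroup W] [Module ℂ W] [Module (KKAlgebra I J K) W]
  [IsScalarTower ℂ (KKAlgebra I J K) W]

/-- The block module coinduced by a module over the Kitaev–Kong algebra. -/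
def coinduced : BlockModule.{max w v₂ v₃} M N I where
  obj m n := (regular I m n).Restriction J K →ₗ[KKAlgebra I J K] W
  act := LinearMap.mk₂ ℂ (fun b φ => φ ∘ₗ rightMul J K b)
    (fun b b' φ => by rw [map_add, LinearMap.comp_add])
    (fun c b φ => by
      ext r
      simp only [map_smul, LinearMap.comp_apply, LinearMap.smul_apply]
      exact φ.map_smul_of_tower c _)
    (fun b φ φ' => by rw [LinearMap.add_comp])
    (fun c b φ => by rw [LinearMap.smul_comp])
  act_mul a b φ := by
    ext r
    simp only [LinearMap.mk₂_apply, LinearMap.comp_apply]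
    congr 1
    ext q
    exact (blockMul_assoc I (r q) a b).symm
  act_one φ := by
    ext r
    simp only [LinearMap.mk₂_apply, LinearMap.comp_apply]
    congr 1
    ext q
    exact blockMul_one I (r q)

/-- These spaces embed into the `ℂ`-linear maps between finite-dimensional spaces. This is the
finiteness needed to represent the coinduced module. -/
instance [FiniteSemisimple M] [FiniteSemisimple N] [FiniteDimensional ℂ W] (m : M) (n : N) :
    FiniteDimensional ℂ ((coinduced (I := I) J K W).obj m n) :=
  Module.Finite.of_injective
    (LinearMap.restrictScalarsₗ ℂ (KKAlgebra I J K) ((regular I m n).Restriction J K) W ℂ)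
    (LinearMap.restrictScalars_injective ℂ)

variable {J K}

/-- The matrix with a single nonzero column. -/
def columnMatrix (q : Fin J.card × Fin K.card)
    (r : (regular I (J.obj q.1) (K.obj q.2)).Restriction J K) : KKAlgebra I J K :=
  fun p => Pi.single q (r p)

theorem columnMatrix_apply_self (q : Fin J.card × Fin K.card)
    (r : (regular I (J.obj q.1) (K.obj q.2)).Restriction J K) (p : Fin J.card × Fin K.card) :
    columnMatrix q r p q = r p :=
  Pi.single_eq_same (M := fun q' : Fin J.card × Fin K.card =>
      Block I (J.obj p.1) (K.obj p.2) (J.obj q'.1) (K.obj q'.2)) q (r p)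

theorem columnMatrix_apply_ne {q q' : Fin J.card × Fin K.card} (h : q' ≠ q)
    (r : (regular I (J.obj q.1) (K.obj q.2)).Restriction J K) (p : Fin J.card × Fin K.card) :
    columnMatrix q r p q' = 0 :=
  Pi.single_eq_of_ne (M := fun q' : Fin J.card × Fin K.card =>
      Block I (J.obj p.1) (K.obj p.2) (J.obj q'.1) (K.obj q'.2)) h (r p)

/-- The inclusion of a column into the Kitaev–Kong algebra. -/
def column (q : Fin J.card × Fin K.card) :
    (regular I (J.obj q.1) (K.obj q.2)).Restriction J K →ₗ[KKAlgebra I J K] KKAlgebra I J K where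
  toFun := columnMatrix q
  map_add' r r' := by
    ext1 p q'
    rw [KKAlgebra.add_apply]
    by_cases h : q' = q
    · subst h
      simp only [columnMatrix_apply_self]
      rfl
    · simp only [columnMatrix_apply_ne h, add_zero]
  map_smul' a r := by
    ext1 p q'
    rw [RingHom.id_apply, smul_eq_mul, KKAlgebra.mul_apply]
    by_cases h : q' = q
    · subst h
      simp only [columnMatrix_apply_self]
      rfl
    · simp only [columnMatrix_apply_ne h, map_zero, Finset.sum_const_zero]

theorem column_apply (q : Fin J.card × Fin K.card)
    (r : (regular I (J.obj q.1) (K.obj q.2)).Restriction J K) :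
    column q r = columnMatrix q r := rfl

/-- Right multiplication by `a` spreads column `p` along row `p` of `a`. This is what makes
`toCoinduced` linear over the algebra. -/
theorem column_mul (p : Fin J.card × Fin K.card)
    (r : (regular I (J.obj p.1) (K.obj p.2)).Restriction J K) (a : KKAlgebra I J K) :
    column p r * a = ∑ q, column q (rightMul J K (a p q) r) := by
  ext1 s q
  rw [KKAlgebra.mul_apply, Finset.sum_eq_single p, KKAlgebra.sum_apply, Finset.sum_eq_single q]
  · simp only [column_apply, columnMatrix_apply_self, rightMul_apply]
  · intro t _ ht
    exact columnMatrix_apply_ne ht.symm _ _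
  · simp
  · intro t _ ht
    rw [column_apply, columnMatrix_apply_ne ht, map_zero, LinearMap.zero_apply]
  · simp

/-- The column of the identity matrix. -/
def oneColumn (q : Fin J.card × Fin K.card) :
    (regular I (J.obj q.1) (K.obj q.2)).Restriction J K :=
  fun p => (1 : KKAlgebra I J K) p q

theorem sum_column_oneColumn :
    ∑ q, column q (oneColumn q) = (1 : KKAlgebra I J K) := by
  ext1 p q
  rw [KKAlgebra.sum_apply, Finset.sum_eq_single q]
  · exact columnMatrix_apply_self _ _ _
  · intro t _ ht
    exact columnMatrix_apply_ne ht.symm _ _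
  · simp

theorem algebra_smul_oneColumn_apply (a : KKAlgebra I J K) (q p : Fin J.card × Fin K.card) :
    (a • oneColumn q) p = a p q :=
  congrFun (congrFun (mul_one a) p) q

theorem column_smul_oneColumn_self (q : Fin J.card × Fin K.card)
    (r : (regular I (J.obj q.1) (K.obj q.2)).Restriction J K) :
    column q r • oneColumn q = r := by
  ext p
  rw [algebra_smul_oneColumn_apply]
  exact columnMatrix_apply_self q r p

theorem column_smul_oneColumn_ne {p q : Fin J.card × Fin K.card} (h : q ≠ p)
    (r : (regular I (J.obj p.1) (K.obj p.2)).Restriction J K) :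
    column p r • oneColumn q =
      (0 : (regular I (J.obj q.1) (K.obj q.2)).Restriction J K) := by
  ext s
  rw [algebra_smul_oneColumn_apply]
  exact columnMatrix_apply_ne h r s

theorem coinduced_restriction_ext {v v' : (coinduced (I := I) J K W).Restriction J K}
    (h : ∀ q (r : (regular I (J.obj q.1) (K.obj q.2)).Restriction J K),
      DFunLike.coe (F := _ →ₗ[KKAlgebra I J K] W) (v q) r =
        DFunLike.coe (F := _ →ₗ[KKAlgebra I J K] W) (v' q) r) : v = v' :=
  funext fun q => LinearMap.ext (h q)

variable (J K) in
/-- The comparison of a module over the Kitaev–Kong algebra with the restriction of its coinduced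
block module. -/
def toCoinduced : W →ₗ[KKAlgebra I J K] (coinduced (I := I) J K W).Restriction J K where
  toFun x q := (LinearMap.toSpanSingleton (KKAlgebra I J K) W x) ∘ₗ column q
  map_add' x y := by
    refine coinduced_restriction_ext W fun q r => ?_
    exact smul_add (column q r) x y
  map_smul' a x := by
    refine coinduced_restriction_ext W fun p r => ?_
    have h : ∀ σ : Finset (Fin J.card × Fin K.card), ∀ φ : Fin J.card × Fin K.card →
        ((regular I (J.obj p.1) (K.obj p.2)).Restriction J K →ₗ[KKAlgebra I J K] W),
        (∑ q ∈ σ, φ q) r = ∑ q ∈ σ, φ q r := fun σ φ => LinearMap.sum_apply _ _ _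
    refine Eq.trans ?_ (h Finset.univ _).symm
    change column p r • a • x = ∑ q, column q (rightMul J K (a p q) r) • x
    rw [← mul_smul, column_mul, Finset.sum_smul]

/-- As a left module `A` is the direct sum of its columns, so this is the isomorphism of `W` with
`Hom_A(A, W)`, split by columns. -/
theorem toCoinduced_bijective : Function.Bijective (toCoinduced (I := I) J K W) := by
  constructor
  · intro x y h
    have h' : ∀ q r, column q r • x = column (I := I) q r • y := fun q r =>
      LinearMap.congr_fun (M₃ := W) (congrFun h q) r
    rw [← one_smul (KKAlgebra I J K) x, ← one_smul (KKAlgebra I J K) y, ← sum_column_oneColumn,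
      Finset.sum_smul, Finset.sum_smul]
    exact Finset.sum_congr rfl fun q _ => h' q _
  · intro φ
    let φ' : ∀ q : Fin J.card × Fin K.card,
      (regular I (J.obj q.1) (K.obj q.2)).Restriction J K →ₗ[KKAlgebra I J K] W := φ
    -- The preimage is the value at `1`, since `1` is the sum of its columns.
    refine ⟨∑ q, φ' q (oneColumn q), ?_⟩
    refine coinduced_restriction_ext W fun p r => ?_
    change column p r • ∑ q, φ' q (oneColumn q) = φ' p r
    rw [Finset.smul_sum, Finset.sum_eq_single p]
    · rw [← map_smul, column_smul_oneColumn_self]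
    · intro q _ h
      rw [← map_smul, column_smul_oneColumn_ne h, map_zero]
    · simp

end BlockModule

end Regular

theorem small_of_finiteDimensional (V : Type*) [AddCommGroup V] [Module ℂ V]
    [FiniteDimensional ℂ V] : Small.{w} V :=
  small_map (Module.finBasis ℂ V).equivFun.toEquiv

/-- A module over an algebra which is finite dimensional for a compatible scalar action belongs
to the category of finite-dimensional representations. -/
theorem finiteDimensional_of (A : Type*) [Ring A] [Algebra ℂ A] (V : Type w) [AddCommGroup V]
    [Module A V] [Module ℂ V] [IsScalarTower ℂ A V] [FiniteDimensional ℂ V] :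
    finiteDimensional.{w} A (ModuleCat.of A V) := by
  -- The scalar tower forces any compatible `ℂ`-action to be the one through `algebraMap`.
  have h : ModuleCat.moduleOfAlgebraModule (ModuleCat.of A V) = ‹Module ℂ V› :=
    Module.ext' _ _ fun c x => algebraMap_smul A c x
  unfold finiteDimensional
  rw [h]
  assumption

/-! ### The functor to representations is fully faithful -/

section Representation

variable {C : Type u₁} [Category.{v₁} C] [Abelian C] [Linear ℂ C] [FiniteSemisimple C]
  [MonoidalCategory C] [MonoidalPreadditive C] [MonoidalLinear ℂ C]
variable {M : Type u₂} [Category.{v₂} M] [Abelian M] [Linear ℂ M] [FiniteSemisimple M]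
  [MonoidalLeftAction C M] [LinearAction C M]
variable {N : Type u₃} [Category.{v₃} N] [Abelian N] [Linear ℂ N] [FiniteSemisimple N]
  [MonoidalLeftAction C N] [LinearAction C N]
variable (I : Irr C) (J : Irr M) (K : Irr N)

namespace LaxModuleFunctor

instance (F : LaxModuleFunctor C M N) (m : M) (n : N) :
    FiniteDimensional ℂ ((F.blockModule I).obj m n) :=
  FiniteSemisimple.finite_hom n (F.toFunctor.obj m)

/-- The vector space `⨁ N(n, F(m))` over `m ∈ Irr(M)` and `n ∈ Irr(N)`. -/
abbrev Total (F : LaxModuleFunctor C M N) : Type v₃ := (F.blockModule I).Restriction J K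

instance (F : LaxModuleFunctor C M N) : Small.{w} (F.Total I J K) :=
  small_of_finiteDimensional _

theorem actBlock_comp {F G : LaxModuleFunctor C M N} (f : F ⟶ G) {m₁ m₂ : M} {n₁ n₂ : N}
    (b : Block I m₁ n₁ m₂ n₂) (v : n₂ ⟶ F.toFunctor.obj m₂) :
    actBlock F I _ _ _ _ b v ≫ f.nat.app m₁ = actBlock G I _ _ _ _ b (v ≫ f.nat.app m₂) := by
  induction b using block_induction with
  | h0 => simp
  | hadd a a' h h' => simp only [map_add, LinearMap.add_apply, Preadditive.add_comp, h, h']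
  | hcls X p g =>
  simp only [actBlock_cls, Category.assoc, actionHomRight_comp, f.nat.naturality]
  rw [reassoc_of% f.comm]

/-- The map on total spaces induced by a morphism of lax module functors. -/
def totalMap {F G : LaxModuleFunctor C M N} (f : F ⟶ G) :
    F.Total I J K →ₗ[KKAlgebra I J K] G.Total I J K :=
  BlockModule.restrictionMap (P := F.blockModule I) (P' := G.blockModule I)
    (fun m n => Linear.rightComp ℂ n (f.nat.app m)) (fun b v => actBlock_comp I f b v)

variable {I J K}

theorem totalMap_apply {F G : LaxModuleFunctor C M N} (f : F ⟶ G) (v : F.Total I J K)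
    (q : Fin J.card × Fin K.card) :
    totalMap I J K f v q = CategoryStruct.comp (obj := N) (v q) (f.nat.app (J.obj q.1)) := rfl

/-- Components at simple objects of `M` are recovered by testing on simple objects of `N`; the other
components follow from naturality along a decomposition. -/
theorem totalMap_injective {F G : LaxModuleFunctor C M N} :
    Function.Injective (totalMap I J K : (F ⟶ G) → _) := by
  intro f g hfg
  have h : ∀ j, f.nat.app (J.obj j) = g.nat.app (J.obj j) := fun j =>
    K.hom_ext fun k s => by
      have := congrFun (LinearMap.congr_fun hfg
        (BlockModule.Restriction.single (P := F.blockModule I) (j, k) s)) (j, k)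
      have e := BlockModule.Restriction.single_apply_self (P := F.blockModule I) (j, k) s
      exact (congrArg (· ≫ f.nat.app (J.obj j)) e).symm.trans
        (this.trans (congrArg (· ≫ g.nat.app (J.obj j)) e))
  ext m
  have D := decomposition J m
  have hm : ∀ φ : F ⟶ G, φ.nat.app m =
      ∑ j, F.toFunctor.map (D.π j) ≫ φ.nat.app _ ≫ G.toFunctor.map (D.ι j) := fun φ => by
    simp only [← φ.nat.naturality, ← Functor.map_comp_assoc, ← Preadditive.sum_comp,
      ← Functor.map_sum, D.sum_π_ι]
    simp
  rw [hm f, hm g]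
  exact Finset.sum_congr rfl fun j _ => by rw [h]

/-- Extend `t` to all pairs and apply Yoneda: the extension is postcomposition with its values on
identities. Equivariance makes these values natural and compatible with the structure morphisms. -/
theorem totalMap_surjective {F G : LaxModuleFunctor C M N} :
    Function.Surjective (totalMap I J K : (F ⟶ G) → _) := by
  intro t
  obtain ⟨T, hT, ht⟩ : ∃ T : ∀ m n, (n ⟶ F.toFunctor.obj m) → (n ⟶ G.toFunctor.obj m),
      (∀ {m₁ m₂ : M} {n₁ n₂ : N} (b : Block I m₁ n₁ m₂ n₂) (v : n₂ ⟶ F.toFunctor.obj m₂),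
        T m₁ n₁ (actBlock F I _ _ _ _ b v) = actBlock G I _ _ _ _ b (T m₂ n₂ v)) ∧
      ∀ v q, t v q = T _ _ (v q) := BlockModule.exists_extension t
  have hact : ∀ (X : C) {m₁ m₂ : M} {n₁ n₂ : N} (p : n₁ ⟶ X ⊙ₗ n₂) (g : X ⊙ₗ m₂ ⟶ m₁)
      (v : n₂ ⟶ F.toFunctor.obj m₂),
      T m₁ n₁ (p ≫ X ⊴ₗ v ≫ F.μ X m₂ ≫ F.toFunctor.map g) =
        p ≫ X ⊴ₗ T m₂ n₂ v ≫ G.μ X m₂ ≫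
          G.toFunctor.map g := fun X m₁ m₂ n₁ n₂ p g v => by
    rw [← actBlock_cls F I, ← actBlock_cls G I]
    exact hT _ _
  let a : ∀ m, F.toFunctor.obj m ⟶ G.toFunctor.obj m := fun m => T m _ (𝟙 (F.toFunctor.obj m))
  have ha : ∀ {m m' : M} {n : N} (v : n ⟶ F.toFunctor.obj m) (g : m ⟶ m'),
      T m' n (v ≫ F.toFunctor.map g) = v ≫ a m ≫ G.toFunctor.map g := fun {m m' n} v g => by
    -- Acting object `𝟙_ C`: unitality removes the structure morphisms, leaving equivariance under
    -- morphisms of `M` and `N`.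
    have := hact (𝟙_ C) (v ≫ (λₗ _).inv) ((λₗ m).hom ≫ g) (𝟙 (F.toFunctor.obj m))
    simpa [a] using this
  have hT_eq : ∀ {m : M} {n : N} (v : n ⟶ F.toFunctor.obj m), T m n v = v ≫ a m :=
    fun {m n} v => by simpa using ha v (𝟙 m)
  refine ⟨⟨{ app := a, naturality := fun m m' g => ?_ }, fun c m => ?_⟩, ?_⟩
  · rw [← hT_eq]
    simpa using ha (𝟙 _) g
  · have := hact c (𝟙 _) (𝟙 _) (𝟙 (F.toFunctor.obj m))
    simp only [actionHomRight_id, CategoryTheory.Functor.map_id, Category.comp_id, Category.id_comp] at this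
    exact (hT_eq _).symm.trans this
  · ext v q
    rw [ht, totalMap_apply]
    exact (hT_eq _).symm

theorem totalMap_add {F G : LaxModuleFunctor C M N} (f g : F ⟶ G) :
    totalMap I J K (f + g) = totalMap I J K f + totalMap I J K g := by
  ext v q
  exact Preadditive.comp_add (C := N) _ _ _ (v q) _ _

theorem totalMap_smul {F G : LaxModuleFunctor C M N} (r : ℂ) (f : F ⟶ G) :
    totalMap I J K (r • f) = r • totalMap I J K f := by
  ext v q
  exact Linear.comp_smul (C := N) _ _ _ (v q) _ _

theorem totalMap_id (F : LaxModuleFunctor C M N) :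
    totalMap I J K (𝟙 F) = LinearMap.id := by
  ext v q
  exact Category.comp_id _

theorem totalMap_comp {F G H : LaxModuleFunctor C M N} (f : F ⟶ G) (g : G ⟶ H) :
    totalMap I J K (f ≫ g) = totalMap I J K g ∘ₗ totalMap I J K f := by
  ext v q
  exact (Category.assoc _ _ _).symm

variable (I J K)

/-- The total space in an arbitrary universe. -/
abbrev ShrinkTotal (F : LaxModuleFunctor C M N) : Type w := Shrink.{w} (F.Total I J K)

/-- The comparison of the total space with its version in an arbitrary universe. -/
abbrev shrinkEquiv (F : LaxModuleFunctor C M N) :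
    ShrinkTotal.{w} I J K F ≃ₗ[KKAlgebra I J K] F.Total I J K :=
  Shrink.linearEquiv (KKAlgebra I J K) (F.Total I J K)

instance (F : LaxModuleFunctor C M N) :
    IsScalarTower ℂ (KKAlgebra I J K) (ShrinkTotal.{w} I J K F) :=
  (equivShrink (F.Total I J K)).symm.isScalarTower ℂ (KKAlgebra I J K)

instance (F : LaxModuleFunctor C M N) : FiniteDimensional ℂ (ShrinkTotal.{w} I J K F) :=
  Module.Finite.equiv (Shrink.linearEquiv ℂ (F.Total I J K)).symm

/-- The map induced by a morphism of lax module functors, in an arbitrary universe. -/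
def shrinkMap {F G : LaxModuleFunctor C M N} (f : F ⟶ G) :
    ShrinkTotal.{w} I J K F →ₗ[KKAlgebra I J K] ShrinkTotal.{w} I J K G :=
  (shrinkEquiv.{w} I J K G).symm.toLinearMap ∘ₗ totalMap I J K f ∘ₗ (shrinkEquiv.{w} I J K F).toLinearMap

theorem shrinkMap_apply {F G : LaxModuleFunctor C M N} (f : F ⟶ G) (x : ShrinkTotal.{w} I J K F) :
    shrinkMap I J K f x =
      (shrinkEquiv.{w} I J K G).symm (totalMap I J K f (shrinkEquiv.{w} I J K F x)) := rfl

variable {I J K}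

theorem shrinkMap_id (F : LaxModuleFunctor C M N) :
    shrinkMap.{w} I J K (𝟙 F) = LinearMap.id := by
  ext1 x
  rw [shrinkMap_apply, totalMap_id, LinearMap.id_apply, LinearMap.id_apply,
    LinearEquiv.symm_apply_apply]

theorem shrinkMap_comp {F G H : LaxModuleFunctor C M N} (f : F ⟶ G) (g : G ⟶ H) :
    shrinkMap.{w} I J K (f ≫ g) = shrinkMap I J K g ∘ₗ shrinkMap I J K f := by
  ext1 x
  rw [LinearMap.comp_apply, shrinkMap_apply, shrinkMap_apply, shrinkMap_apply, totalMap_comp,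
    LinearEquiv.apply_symm_apply, LinearMap.comp_apply]

theorem shrinkMap_add {F G : LaxModuleFunctor C M N} (f g : F ⟶ G) :
    shrinkMap.{w} I J K (f + g) = shrinkMap I J K f + shrinkMap I J K g := by
  ext1 x
  rw [LinearMap.add_apply, shrinkMap_apply, shrinkMap_apply, shrinkMap_apply, totalMap_add,
    LinearMap.add_apply, map_add]

theorem shrinkMap_smul_apply {F G : LaxModuleFunctor C M N} (r : ℂ) (f : F ⟶ G)
    (x : ShrinkTotal.{w} I J K F) :
    shrinkMap.{w} I J K (r • f) x = algebraMap ℂ (KKAlgebra I J K) r • shrinkMap I J K f x := by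
  rw [shrinkMap_apply, shrinkMap_apply, totalMap_smul, LinearMap.smul_apply,
    ← algebraMap_smul (KKAlgebra I J K) r, map_smul]

theorem shrinkMap_injective {F G : LaxModuleFunctor C M N} :
    Function.Injective (shrinkMap.{w} I J K : (F ⟶ G) → _) := by
  intro f g h
  refine totalMap_injective (I := I) (J := J) (K := K) (LinearMap.ext fun v => ?_)
  have h' := LinearMap.congr_fun h ((shrinkEquiv.{w} I J K F).symm v)
  rw [shrinkMap_apply, shrinkMap_apply, LinearEquiv.apply_symm_apply] at h'
  exact (shrinkEquiv.{w} I J K G).symm.injective h'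

theorem shrinkMap_surjective {F G : LaxModuleFunctor C M N} :
    Function.Surjective (shrinkMap.{w} I J K : (F ⟶ G) → _) := by
  intro t
  obtain ⟨f, hf⟩ := totalMap_surjective (I := I) (J := J) (K := K) (F := F) (G := G)
    ((shrinkEquiv.{w} I J K G).toLinearMap ∘ₗ t ∘ₗ (shrinkEquiv.{w} I J K F).symm.toLinearMap)
  refine ⟨f, LinearMap.ext fun x => ?_⟩
  rw [shrinkMap_apply, hf, LinearMap.comp_apply, LinearMap.comp_apply, LinearEquiv.coe_coe,
    LinearEquiv.coe_coe, LinearEquiv.symm_apply_apply, LinearEquiv.symm_apply_apply]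

variable (I J K)

/-- The functor from lax module functors to representations of the Kitaev–Kong algebra which sends
`F` to `⨁ N(n, F(m))`. -/
def toRep : LaxModuleFunctor C M N ⥤ Rep.{w} (KKAlgebra I J K) where
  obj F := ⟨ModuleCat.of _ (F.ShrinkTotal I J K), finiteDimensional_of _ _⟩
  map f := ObjectProperty.homMk (ModuleCat.ofHom (shrinkMap I J K f))
  map_id F := ObjectProperty.hom_ext _ (ModuleCat.hom_ext (shrinkMap_id F))
  map_comp f g := ObjectProperty.hom_ext _ (ModuleCat.hom_ext (shrinkMap_comp f g))

instance : (toRep.{w} I J K : LaxModuleFunctor C M N ⥤ _).Additive where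
  map_add {_ _ f g} := ObjectProperty.hom_ext _ (ModuleCat.hom_ext (shrinkMap_add f g))

instance : (toRep.{w} I J K : LaxModuleFunctor C M N ⥤ _).Linear ℂ where
  map_smul f r := ObjectProperty.hom_ext _ (ModuleCat.hom_ext (LinearMap.ext fun x =>
    shrinkMap_smul_apply r f x))

instance : (toRep.{w} I J K : LaxModuleFunctor C M N ⥤ _).Faithful where
  map_injective h := shrinkMap_injective.{w}
    (congrArg ModuleCat.Hom.hom (congrArg InducedCategory.Hom.hom h))

instance : (toRep.{w} I J K : LaxModuleFunctor C M N ⥤ _).Full where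
  map_surjective t := by
    obtain ⟨f, hf⟩ := shrinkMap_surjective.{w} (I := I) (J := J) (K := K) t.hom.hom
    exact ⟨f, ObjectProperty.hom_ext _ (ModuleCat.hom_ext hf)⟩

end LaxModuleFunctor

/-! ### Essential surjectivity -/

namespace BlockModule

variable {I J K} {P : BlockModule.{w} M N I} {R : M → N} {u : ∀ m, P.obj m (R m)}
  (hu : ∀ m, P.IsUniversal (u m))

/-- The Yoneda isomorphism given by the universal elements respects block actions. On classes this
follows from the defining property of `functorμ`. -/
theorem pull_actBlock_univ {m₁ m₂ : M} {n₁ n₂ : N} (b : Block I m₁ n₁ m₂ n₂)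
    (v : n₂ ⟶ (laxModuleFunctor hu).toFunctor.obj m₂) :
    P.pull (actBlock (laxModuleFunctor hu) I _ _ _ _ b v) (univ hu m₁) =
      P.act b (P.pull v (univ hu m₂)) := by
  induction b using block_induction with
  | h0 => simp
  | hadd a a' h h' => simp only [map_add, LinearMap.add_apply, h, h']
  | hcls X p g =>
  rw [act_cls, actBlock_cls]
  change P.pull (p ≫ X ⊴ₗ v ≫ functorμ hu X m₂ ≫
    (functor hu).map g) (univ hu m₁) = _
  rw [pull_comp, pull_comp, pull_comp, pull_functor_map, pull_push, pull_functorμ, str_pull,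
    pull_push, pull_push]

/-- The total space of the functor represented by a block module is its restriction. -/
def totalEquiv :
    (laxModuleFunctor hu).Total I J K ≃ₗ[KKAlgebra I J K] P.Restriction J K :=
  LinearEquiv.ofBijective
    (restrictionMap (P := (laxModuleFunctor hu).blockModule I)
      (fun m n => P.pull.flip (univ hu m)) (fun b v => pull_actBlock_univ hu b v))
    ⟨fun v w h => funext fun q => (isUniversal_univ hu (J.obj q.1) (K.obj q.2)).1 (congrFun h q),
      fun v => by
        choose w hw using fun q : Fin J.card × Fin K.card =>
          (isUniversal_univ hu (J.obj q.1) (K.obj q.2)).2 (v q)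
        exact ⟨w, funext hw⟩⟩

end BlockModule

namespace LaxModuleFunctor

/-- The preimage of `V` is the functor represented by its coinduced block module: its total space is
the restriction of that module, hence `V`. -/
instance : (toRep.{w} I J K : LaxModuleFunctor C M N ⥤ _).EssSurj where
  mem_essImage V := by
    let _ := ModuleCat.moduleOfAlgebraModule (k := ℂ) V.obj
    have := ModuleCat.isScalarTower_of_algebra_moduleCat (k := ℂ) V.obj
    have : FiniteDimensional ℂ V.obj := V.property
    choose R u hu using fun m =>
      (BlockModule.coinduced (I := I) J K V.obj).exists_isUniversal K m
    refine ⟨BlockModule.laxModuleFunctor hu, ⟨ObjectProperty.isoMk _ (LinearEquiv.toModuleIso ?_)⟩⟩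
    exact Shrink.linearEquiv _ _ ≪≫ₗ BlockModule.totalEquiv hu ≪≫ₗ
      (LinearEquiv.ofBijective (BlockModule.toCoinduced J K V.obj)
        (BlockModule.toCoinduced_bijective V.obj)).symm

instance : (toRep.{w} I J K : LaxModuleFunctor C M N ⥤ _).IsEquivalence where

end LaxModuleFunctor

end Representation

/-! ### Rigidity makes lax structure morphisms invertible -/

section Rigid

variable {C : Type u₁} [Category.{v₁} C] [MonoidalCategory C]
variable {M : Type u₂} [Category.{v₂} M] [Preadditive M] [Linear ℂ M] [MonoidalLeftAction C M]
variable {N : Type u₃} [Category.{v₃} N] [Preadditive N] [Linear ℂ N] [MonoidalLeftAction C N]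

/-- The triangle identity for `X`, acting on `m`, with associators and unitors rewritten through
those of the action. -/
theorem coevaluation_evaluation_action (X Y : C) [ExactPairing X Y] (m : M) :
    (λₗ (X ⊙ₗ m)).inv ≫ (η_ X Y) ⊵ₗ (X ⊙ₗ m) ≫ (αₗ X Y (X ⊙ₗ m)).hom ≫
      X ⊴ₗ ((αₗ Y X m).inv ≫ (ε_ X Y) ⊵ₗ m ≫ (λₗ m).hom) = 𝟙 _ := by
  have h := congrArg (· ⊵ₗ m) (ExactPairing.evaluation_coevaluation X Y)
  simp only [comp_actionHomLeft, whiskerRight_actionHomLeft, whiskerLeft_actionHomLeft,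
    leftUnitor_actionHom, Category.assoc] at h
  have key : (αₗ (X ⊗ Y) X m).inv ≫ (α_ X Y X).hom ⊵ₗ m ≫ (αₗ X (Y ⊗ X) m).hom =
      (αₗ X Y (X ⊙ₗ m)).hom ≫ X ⊴ₗ (αₗ Y X m).inv := by
    rw [Iso.inv_comp_eq, ← cancel_mono (X ⊴ₗ (αₗ Y X m).hom)]
    simp
  rw [reassoc_of% key, cancel_epi] at h
  have h' := h =≫ (ρ_ X).hom ⊵ₗ m
  simp only [Category.assoc, inv_hom_actionHomLeft, Category.comp_id] at h'
  rw [Iso.inv_comp_eq, Category.comp_id, ← h', rightUnitor_actionHom, Iso.inv_hom_id_assoc]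
  simp only [actionHomRight_comp]

namespace LaxModuleFunctor

/-- The candidate inverse goes `F(X ⊙ m) ⟶ X ⊙ (Y ⊙ F(X ⊙ m)) ⟶ X ⊙ F(Y ⊙ (X ⊙ m)) ⟶ X ⊙ F(m)`.
Moving `F.μ X m` past the coevaluation and using coherence of `F` reduces the composite to the
triangle identity on `F(m)`. -/
theorem coevaluation_comp_μ (F : LaxModuleFunctor C M N) (X Y : C) [ExactPairing X Y] (m : M) :
    F.μ X m ≫ (λₗ _).inv ≫ (η_ X Y) ⊵ₗ _ ≫ (αₗ X Y _).hom ≫ X ⊴ₗ (F.μ Y (X ⊙ₗ m) ≫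
      F.toFunctor.map ((αₗ Y X m).inv ≫ (ε_ X Y) ⊵ₗ m ≫ (λₗ m).hom)) = 𝟙 _ := by
  have h : Y ⊴ₗ F.μ X m ≫ F.μ Y (X ⊙ₗ m) ≫ F.toFunctor.map ((αₗ Y X m).inv ≫
      (ε_ X Y) ⊵ₗ m ≫ (λₗ m).hom) =
      (αₗ Y X _).inv ≫ (ε_ X Y) ⊵ₗ F.toFunctor.obj m ≫ (λₗ _).hom := by
    simp
  have hα : (αₗ X Y (X ⊙ₗ F.toFunctor.obj m)).hom ≫ X ⊴ₗ Y ⊴ₗ F.μ X m =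
      (X ⊗ Y) ⊴ₗ F.μ X m ≫ (αₗ X Y _).hom := by
    simp
  rw [← coevaluation_evaluation_action X Y (F.toFunctor.obj m), ← h,
    actionHomRight_comp _ (Y ⊴ₗ F.μ X m), reassoc_of% hα, ← action_exchange_assoc,
    reassoc_of% actionUnitIso_inv_naturality]

/-- Associativity merges the structure morphisms for `X` and `Y` into the one for `X ⊗ Y`;
naturality along the coevaluation and unitality remove it, leaving `F` applied to the triangle
identity on `m`. -/
theorem μ_comp_coevaluation (F : LaxModuleFunctor C M N) (X Y : C) [ExactPairing X Y] (m : M) :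
    ((λₗ _).inv ≫ (η_ X Y) ⊵ₗ _ ≫ (αₗ X Y _).hom ≫ X ⊴ₗ (F.μ Y (X ⊙ₗ m) ≫
      F.toFunctor.map ((αₗ Y X m).inv ≫ (ε_ X Y) ⊵ₗ m ≫ (λₗ m).hom))) ≫ F.μ X m = 𝟙 _ := by
  rw [← F.toFunctor.map_id, ← coevaluation_evaluation_action X Y m]
  generalize (αₗ Y X m).inv ≫ (ε_ X Y) ⊵ₗ m ≫ (λₗ m).hom = g
  simp only [actionHomRight_comp, Category.assoc, Functor.LaxLeftLinear.μₗ_naturality_right]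
  rw [← Functor.LaxLeftLinear.μₗ_associativity_assoc,
    Functor.LaxLeftLinear.μₗ_naturality_left_assoc,
    Functor.LaxLeftLinear.μₗ_unitality_inv_assoc]
  simp only [CategoryTheory.Functor.map_comp]

theorem isIso_μ (F : LaxModuleFunctor C M N) (X Y : C) [ExactPairing X Y] (m : M) :
    IsIso (F.μ X m) :=
  ⟨_, F.coevaluation_comp_μ X Y m, F.μ_comp_coevaluation X Y m⟩

end LaxModuleFunctor

theorem strong_of_rigid [RigidCategory C] (F : LaxModuleFunctor C M N) : strong C M N F :=
  fun c m => F.isIso_μ c cᘁ m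

instance [RigidCategory C] : (strong C M N).ι.EssSurj where
  mem_essImage F := ⟨⟨F, strong_of_rigid F⟩, ⟨Iso.refl _⟩⟩

end Rigid

end

end KitaevKong

theorem mainTheorem7
    {C : Type u₁} [Category.{v₁} C] [Abelian C] [Linear ℂ C] [KitaevKong.FiniteSemisimple C]
    [MonoidalCategory C] [MonoidalPreadditive C] [MonoidalLinear ℂ C]
    {M : Type u₂} [Category.{v₂} M] [Abelian M] [Linear ℂ M] [KitaevKong.FiniteSemisimple M]
    [MonoidalLeftAction C M] [KitaevKong.LinearAction C M]
    {N : Type u₃} [Category.{v₃} N] [Abelian N] [Linear ℂ N] [KitaevKong.FiniteSemisimple N]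
    [MonoidalLeftAction C N] [KitaevKong.LinearAction C N]
    (I : KitaevKong.Irr C) (J : KitaevKong.Irr M) (K : KitaevKong.Irr N) :
    (∃ e : KitaevKong.LaxModuleFunctor C M N ≌
        KitaevKong.Rep.{w} (KitaevKong.KKAlgebra I J K),
      ∃ _ : e.functor.Additive, e.functor.Linear ℂ) ∧
    (∀ [RigidCategory C],
      ∃ e : KitaevKong.StrongModuleFunctor C M N ≌
          KitaevKong.Rep.{w} (KitaevKong.KKAlgebra I J K),
        ∃ _ : e.functor.Additive, e.functor.Linear ℂ) := by
  let Φ : KitaevKong.LaxModuleFunctor C M N ⥤ KitaevKong.Rep.{w} (KitaevKong.KKAlgebra I J K) :=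
    KitaevKong.LaxModuleFunctor.toRep.{w} I J K
  refine ⟨⟨Φ.asEquivalence, inferInstanceAs Φ.Additive, inferInstanceAs (Φ.Linear ℂ)⟩, ?_⟩
  intro _
  let ι := (KitaevKong.strong C M N).ι
  -- The inclusion is fully faithful, and by rigidity it is essentially surjective.
  have : ι.IsEquivalence := { }
  exact ⟨(ι ⋙ Φ).asEquivalence, inferInstanceAs (ι ⋙ Φ).Additive,
    inferInstanceAs ((ι ⋙ Φ).Linear ℂ)⟩
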